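/- Let $p$ be an odd prime, $K$ a field of characteristic $p$, $G$ a finite cyclic group with $p \mid |G|$, and $A = KG$ its group algebra. Let $HH^n(A)$ ($n\ge 0$) be the Hochschild cohomology of $A$, computed by the Hochschild complex $C^n(A)=\mathrm{Hom}_K(A^{\otimes n},A)$, and let $[\,\cdot\,,\,\cdot\,]$ be the Gerstenhaber bracket. It makes $HH^1(A)$ a Lie algebra and every $HH^n(A)$ a Lie module over $HH^1(A)$. Sending the class of a $1$-cocycle $f$ to the map $a\mapsto f(a)$ is an isomorphism of Lie algebras $\theta: HH^1(A)\to \mathrm{Der}_K(A)$. The Lie algebra $\mathrm{Der}_K(A)$ is the Witt algebra: for every generator $g$ of $G$ it has a $K$-basis $(D_i)_{i\in\mathbb Z/|G|}$ of derivations with $D_i(g)=g^{i+1}$, and $[D_i,D_j]=(j-i)D_{i+j}$, where $j-i$ is computed in $K$ (well defined since $p$ divides $|G|$) and $i+j$ modulo $|G|$. (i) If $n$ is odd, then $HH^n(A)$ is isomorphic to the adjoint module: there is a $K$-linear isomorphism $e: HH^n(A)\to \mathrm{Der}_K(A)$ with $e([D,\xi])=[\theta(D),e(\xi)]$ for all $D\in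 HH^1(A)$, $\xi\in HH^n(A)$. (ii) If $n$ is even, then $HH^n(A)$ is isomorphic to the standard module: there is a $K$-linear isomorphism $e: HH^n(A)\to A$ with $e([D,\xi])=\theta(D)(e(\xi))$ for all $D\in HH^1(A)$, $\xi\in HH^n(A)$. -/

import Mathlib

namespace Hochschild

open Function

/-- Hochschild `n`-cochains `Hom_K(A^{⊗ n}, A)`, written as `K`-multilinear maps `Aⁿ → A`. -/
abbrev Cochain (K A : Type*) [CommRing K] [Ring A] [Algebra K A] (n : ℕ) : Type _ :=
  MultilinearMap K (fun _ : Fin n => A) A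

/-- Mathlib's additive group structure, recorded for `Cochain` so that quotients of submodules
of cochains are found. -/
instance Cochain.instAddCommGroup (K A : Type*) [CommRing K] [Ring A] [Algebra K A] (n : ℕ) :
    AddCommGroup (Cochain K A n) :=
  MultilinearMap.instAddCommGroup

section General

variable {K A : Type*} [CommRing K] [Ring A] [Algebra K A]

/-- Precomposition of a cochain with a map of tuples that is linear in each slot: changing one
entry `x l` of the argument changes a single entry of `P x`, linearly in the new value. -/
def Cochain.pull {n k : ℕ} (f : Cochain K A n) (P : (Fin k → A) → Fin n → A)
    (hP : ∀ (x : Fin k → A) (l : Fin k), ∃ (j : Fin n) (φ : A →ₗ[K] A),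
      ∀ v, P (update x l v) = update (P x) j (φ v)) : Cochain K A k :=
  MultilinearMap.mk' (fun x => f (P x))
    (by
      intro x l a b
      obtain ⟨j, φ, h⟩ := hP x l
      simp only [h, map_add, MultilinearMap.map_update_add])
    (by
      intro x l c a
      obtain ⟨j, φ, h⟩ := hP x l
      simp only [h, map_smul, MultilinearMap.map_update_smul])

theorem contractNth_update {n : ℕ} (i : Fin n) (x : Fin (n + 1) → A) (l : Fin (n + 1)) :
    ∃ (j : Fin n) (φ : A →ₗ[K] A), ∀ v,
      Fin.contractNth i.castSucc (· * ·) (update x l v) =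
        update (Fin.contractNth i.castSucc (· * ·) x) j (φ v) := by
  rcases lt_trichotomy (l : ℕ) i with h | h | h
  · refine ⟨⟨l, by omega⟩, LinearMap.id, fun v => ?_⟩
    funext j
    simp only [Fin.contractNth, update_apply, Fin.ext_iff, Fin.val_castSucc, Fin.val_succ,
      LinearMap.id_apply]
    split_ifs <;> first | rfl | omega
  · refine ⟨i, LinearMap.mulRight K (x i.succ), fun v => ?_⟩
    funext j
    by_cases hj : j = i
    · subst hj
      simp [Fin.contractNth, update_apply, Fin.ext_iff, ← h]
    · have hj' : (j : ℕ) ≠ i := fun e => hj (Fin.ext e)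
      simp only [Fin.contractNth, update_apply, Fin.ext_iff, Fin.val_castSucc, Fin.val_succ]
      split_ifs <;> first | rfl | omega
  · by_cases h' : (l : ℕ) = i + 1
    · refine ⟨i, LinearMap.mulLeft K (x i.castSucc), fun v => ?_⟩
      funext j
      by_cases hj : j = i
      · subst hj
        simp [Fin.contractNth, update_apply, Fin.ext_iff, h']
      · have hj' : (j : ℕ) ≠ i := fun e => hj (Fin.ext e)
        simp only [Fin.contractNth, update_apply, Fin.ext_iff, Fin.val_castSucc, Fin.val_succ]
        split_ifs <;> first | rfl | omega
    · refine ⟨⟨l - 1, by omega⟩, LinearMap.id, fun v => ?_⟩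
      funext j
      simp only [Fin.contractNth, update_apply, Fin.ext_iff, Fin.val_castSucc, Fin.val_succ,
        LinearMap.id_apply]
      split_ifs <;> first | rfl | omega

/-- `(x₀, …, xₙ) ↦ x₀ f(x₁, …, xₙ)`. -/
def Cochain.mulLeft {n : ℕ} (f : Cochain K A n) : Cochain K A (n + 1) :=
  MultilinearMap.mk' (fun x => x 0 * f (Fin.tail x))
    (by
      intro x l a b
      induction l using Fin.cases <;>
        simp [Fin.tail_update_zero, Fin.tail_update_succ, add_mul, mul_add,
          (Fin.succ_ne_zero _).symm])
    (by
      intro x l c a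
      induction l using Fin.cases <;>
        simp [Fin.tail_update_zero, Fin.tail_update_succ,
          (Fin.succ_ne_zero _).symm])

/-- `(x₀, …, xₙ) ↦ f(x₀, …, xₙ₋₁) xₙ`. -/
def Cochain.mulRight {n : ℕ} (f : Cochain K A n) : Cochain K A (n + 1) :=
  MultilinearMap.mk' (fun x => f (Fin.init x) * x (Fin.last n))
    (by
      intro x l a b
      induction l using Fin.lastCases <;>
        simp [Fin.init_update_last, Fin.init_update_castSucc, add_mul, mul_add,
          (Fin.castSucc_lt_last _).ne'])
    (by
      intro x l c a
      induction l using Fin.lastCases <;>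
        simp [Fin.init_update_last, Fin.init_update_castSucc, (Fin.castSucc_lt_last _).ne'])

/-- `(x₀, …, xₙ) ↦ f(x₀, …, xᵢ xᵢ₊₁, …, xₙ)`. -/
def Cochain.contract {n : ℕ} (f : Cochain K A n) (i : Fin n) : Cochain K A (n + 1) :=
  f.pull (Fin.contractNth i.castSucc (· * ·)) (contractNth_update i)

/-- The Hochschild differential
`(δ f)(x₀, …, xₙ) = x₀ f(x₁, …, xₙ) + ∑_{i < n} (-1)^{i+1} f(x₀, …, xᵢ xᵢ₊₁, …, xₙ)
  + (-1)^{n+1} f(x₀, …, xₙ₋₁) xₙ`. -/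
def delta (K A : Type*) [CommRing K] [Ring A] [Algebra K A] (n : ℕ) :
    Cochain K A n →ₗ[K] Cochain K A (n + 1) where
  toFun f := f.mulLeft + ∑ i : Fin n, (-1 : K) ^ ((i : ℕ) + 1) • f.contract i +
    (-1 : K) ^ (n + 1) • f.mulRight
  map_add' f g := by
    ext x
    simp [Cochain.mulLeft, Cochain.mulRight, Cochain.contract, Cochain.pull, mul_add, add_mul,
      Finset.sum_add_distrib, smul_add]
    abel
  map_smul' c f := by
    ext x
    simp [Cochain.mulLeft, Cochain.mulRight, Cochain.contract, Cochain.pull, smul_add,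
      Finset.smul_sum, smul_comm c]

theorem delta_apply {n : ℕ} (f : Cochain K A n) (x : Fin (n + 1) → A) :
    delta K A n f x = x 0 * f (Fin.tail x) +
      ∑ i : Fin n, (-1 : K) ^ ((i : ℕ) + 1) • f (Fin.contractNth i.castSucc (· * ·) x) +
      (-1 : K) ^ (n + 1) • (f (Fin.init x) * x (Fin.last n)) := by
  simp [delta, Cochain.mulLeft, Cochain.mulRight, Cochain.contract, Cochain.pull]

/-- Hochschild cocycles. -/
def cocycles (K A : Type*) [CommRing K] [Ring A] [Algebra K A] (n : ℕ) :
    Submodule K (Cochain K A n) :=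
  LinearMap.ker (delta K A n)

/-- Hochschild coboundaries. -/
def coboundaries (K A : Type*) [CommRing K] [Ring A] [Algebra K A] :
    (n : ℕ) → Submodule K (Cochain K A n)
  | 0 => ⊥
  | n + 1 => LinearMap.range (delta K A n)

/-- The Hochschild cohomology `HHⁿ(A)`, cocycles modulo coboundaries. -/
def HH (K A : Type*) [CommRing K] [Ring A] [Algebra K A] (n : ℕ) : Type _ :=
  cocycles K A n ⧸ (coboundaries K A n).submoduleOf (cocycles K A n)

instance HH.instAddCommGroup (n : ℕ) : AddCommGroup (HH K A n) :=
  inferInstanceAs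
    (AddCommGroup (cocycles K A n ⧸ (coboundaries K A n).submoduleOf (cocycles K A n)))

instance HH.instModule (n : ℕ) : Module K (HH K A n) :=
  inferInstanceAs
    (Module K (cocycles K A n ⧸ (coboundaries K A n).submoduleOf (cocycles K A n)))

/-- The class of a cocycle. -/
def HH.mk (K A : Type*) [CommRing K] [Ring A] [Algebra K A] (n : ℕ) :
    cocycles K A n →ₗ[K] HH K A n :=
  ((coboundaries K A n).submoduleOf (cocycles K A n)).mkQ

theorem HH.mk_surjective (n : ℕ) : Surjective (HH.mk K A n) :=
  Submodule.mkQ_surjective _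

theorem HH.mk_eq_zero {n : ℕ} {f : cocycles K A n} :
    HH.mk K A n f = 0 ↔ (f : Cochain K A n) ∈ coboundaries K A n :=
  Submodule.Quotient.mk_eq_zero _

/-- A linear map on cocycles that kills coboundaries descends to cohomology. -/
def HH.lift {n : ℕ} {M : Type*} [AddCommGroup M] [Module K M] (φ : cocycles K A n →ₗ[K] M)
    (hφ : ∀ f : cocycles K A n, (f : Cochain K A n) ∈ coboundaries K A n → φ f = 0) :
    HH K A n →ₗ[K] M :=
  Submodule.liftQ ((coboundaries K A n).submoduleOf (cocycles K A n)) φ hφ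

theorem HH.lift_mk {n : ℕ} {M : Type*} [AddCommGroup M] [Module K M]
    (φ : cocycles K A n →ₗ[K] M)
    (hφ : ∀ f : cocycles K A n, (f : Cochain K A n) ∈ coboundaries K A n → φ f = 0)
    (f : cocycles K A n) : HH.lift φ hφ (HH.mk K A n f) = φ f :=
  rfl

/-! ### The Gerstenhaber bracket on cochains

The target degree `n + m - 1` is a variable `k` with `k + 1 = n + m`. Positions are counted
from `0`. -/

/-- The tuple `(x₀, …, xᵢ₋₁, g(xᵢ, …, xᵢ₊ₘ₋₁), xᵢ₊ₘ, …, x_{n+m-2})` of length `n`. -/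
def insertArg {n m k : ℕ} (h : k + 1 = n + m) (g : Cochain K A m) (i : Fin n) (x : Fin k → A)
    (j : Fin n) : A :=
  if hlt : j < i then x ⟨j, by have := i.isLt; have := Fin.lt_def.1 hlt; omega⟩
  else if heq : j = i then g fun l => x ⟨i + l, by have := i.isLt; have := l.isLt; omega⟩
  else x ⟨j + m - 1, by
    have := i.isLt; have := j.isLt
    have : (j : ℕ) ≠ i := fun e => heq (Fin.ext e)
    have : ¬ (j : ℕ) < i := fun e => hlt (Fin.lt_def.2 e)
    omega⟩

theorem insertArg_update {n m k : ℕ} (h : k + 1 = n + m) (g : Cochain K A m) (i : Fin n)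
    (x : Fin k → A) (l : Fin k) :
    ∃ (j : Fin n) (φ : A →ₗ[K] A), ∀ v,
      insertArg h g i (update x l v) = update (insertArg h g i x) j (φ v) := by
  have hi := i.isLt
  have hl := l.isLt
  by_cases h1 : (l : ℕ) < i
  · refine ⟨⟨l, by omega⟩, LinearMap.id, fun v => ?_⟩
    funext j
    simp only [insertArg, update_apply, Fin.ext_iff, Fin.lt_def, LinearMap.id_apply]
    split_ifs <;> first | rfl | omega | (congr 1; funext r; rw [if_neg (by omega)])
  · by_cases h2 : (l : ℕ) < i + m
    · refine ⟨i, g.toLinearMap (fun r => x ⟨i + r, by have := r.isLt; omega⟩)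
        ⟨l - i, by omega⟩, fun v => ?_⟩
      funext j
      by_cases hj : j = i
      · subst hj
        simp only [insertArg, update_apply, lt_irrefl, dite_false, dite_true, if_true,
          MultilinearMap.toLinearMap_apply]
        congr 1
        funext r
        simp only [update_apply, Fin.ext_iff]
        split_ifs <;> first | rfl | omega
      · have hj' : (j : ℕ) ≠ i := fun e => hj (Fin.ext e)
        have hjn := j.isLt
        simp only [insertArg, update_apply, Fin.ext_iff, Fin.lt_def, hj', dite_false, if_false]
        split_ifs <;> first | rfl | omega
    · refine ⟨⟨l + 1 - m, by omega⟩, LinearMap.id, fun v => ?_⟩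
      funext j
      have hjn := j.isLt
      simp only [insertArg, update_apply, Fin.ext_iff, Fin.lt_def, LinearMap.id_apply]
      split_ifs <;> first | rfl | omega | (congr 1; funext r; rw [if_neg (by omega)])

/-- The partial composition `f ∘ᵢ g`. -/
def circAt {n m k : ℕ} (h : k + 1 = n + m) (f : Cochain K A n) (g : Cochain K A m) (i : Fin n) :
    Cochain K A k :=
  f.pull (insertArg h g i) (insertArg_update h g i)

/-- `f ∘ g = ∑ᵢ (-1)^{i (m-1)} f ∘ᵢ g`, with `i` counted from `0`; the exponent is written with
`m + 1`, which has the parity of `m - 1`. It is `0` for `n = 0`. -/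
def circ {n m k : ℕ} (h : k + 1 = n + m) (f : Cochain K A n) (g : Cochain K A m) : Cochain K A k :=
  ∑ i : Fin n, (-1 : K) ^ ((i : ℕ) * (m + 1)) • circAt h f g i

/-- The Gerstenhaber bracket `[f, g] = f ∘ g - (-1)^{(n-1)(m-1)} g ∘ f` on cochains; the exponent
is written with `(n + 1) (m + 1)`, which has the same parity. -/
def bracket {n m k : ℕ} (h : k + 1 = n + m) (f : Cochain K A n) (g : Cochain K A m) :
    Cochain K A k :=
  circ h f g - (-1 : K) ^ ((n + 1) * (m + 1)) • circ (h.trans (add_comm n m)) g f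

/-- The linear endomorphism of `A` given by a `1`-cochain. -/
def Cochain.toEnd (D : Cochain K A 1) : Module.End K A where
  toFun a := D fun _ => a
  map_add' a b := by
    have h : ∀ v : A, update (fun _ : Fin 1 => (0 : A)) 0 v = fun _ => v := fun v => by
      funext i; simp [Subsingleton.elim i 0]
    have := D.map_update_add (fun _ => 0) 0 a b
    simpa only [h] using this
  map_smul' c a := by
    have h : ∀ v : A, update (fun _ : Fin 1 => (0 : A)) 0 v = fun _ => v := fun v => by
      funext i; simp [Subsingleton.elim i 0]
    have := D.map_update_smul (fun _ => 0) 0 c a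
    simpa only [h, RingHom.id_apply] using this

theorem bracket_one_apply {n : ℕ} (D : Cochain K A 1) (f : Cochain K A n) (x : Fin n → A) :
    bracket (add_comm n 1) D f x =
      D.toEnd (f x) - ∑ i : Fin n, f (update x i (D.toEnd (x i))) := by
  have h1 : circ (add_comm n 1) D f x = D.toEnd (f x) := by
    simp only [circ, Finset.univ_unique, Fin.default_eq_zero, Finset.sum_singleton, Fin.val_zero,
      zero_mul, pow_zero, one_smul]
    change D _ = D _
    congr 1
    funext j
    simp [insertArg, Subsingleton.elim j 0]
  have h2 : circ ((add_comm n 1).trans (add_comm 1 n)) f D x =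
      ∑ i : Fin n, f (update x i (D.toEnd (x i))) := by
    simp only [circ, sum_apply, smul_apply]
    refine Finset.sum_congr rfl fun i _ => ?_
    rw [pow_mul', (by norm_num : (-1 : K) ^ (1 + 1) = 1), one_pow, one_smul]
    change f _ = f _
    congr 1
    funext j
    by_cases hj : j = i
    · subst hj
      simp only [insertArg, lt_irrefl, dite_false, dite_true, update_self]
      change D _ = D _
      congr 1
      funext l
      congr 1
      ext
      simp [Subsingleton.elim l 0]
    · simp only [insertArg, hj, dite_false, update_of_ne hj]
      split_ifs <;> rfl
  rw [bracket, sub_apply, smul_apply, h1, h2, pow_mul,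
    (by norm_num : (-1 : K) ^ (1 + 1) = 1), one_pow, one_smul]

/-- The Gerstenhaber bracket with cochains of degree one, as a bilinear map. -/
def bracketOne (K A : Type*) [CommRing K] [Ring A] [Algebra K A] (n : ℕ) :
    Cochain K A 1 →ₗ[K] Module.End K (Cochain K A n) :=
  LinearMap.mk₂ K (fun D f => bracket (add_comm n 1) D f)
    (by
      intro D E f
      ext x
      simp only [bracket_one_apply, add_apply, Cochain.toEnd, LinearMap.coe_mk,
        AddHom.coe_mk, MultilinearMap.map_update_add, Finset.sum_add_distrib]
      abel)
    (by
      intro c D f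
      ext x
      simp only [bracket_one_apply, smul_apply, Cochain.toEnd, LinearMap.coe_mk,
        AddHom.coe_mk, MultilinearMap.map_update_smul, smul_sub, Finset.smul_sum])
    (by
      intro D f g
      ext x
      simp only [bracket_one_apply, add_apply, map_add, Finset.sum_add_distrib]
      abel)
    (by
      intro c D f
      ext x
      simp only [bracket_one_apply, smul_apply, map_smul, smul_sub,
        Finset.smul_sum])

theorem bracketOne_apply {n : ℕ} (D : Cochain K A 1) (f : Cochain K A n) (x : Fin n → A) :
    bracketOne K A n D f x =
      D.toEnd (f x) - ∑ i : Fin n, f (update x i (D.toEnd (x i))) :=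
  bracket_one_apply D f x

theorem toEnd_bracketOne (D E : Cochain K A 1) (a : A) :
    (bracketOne K A 1 D E).toEnd a = D.toEnd (E.toEnd a) - E.toEnd (D.toEnd a) := by
  change bracketOne K A 1 D E (fun _ => a) = _
  rw [bracketOne_apply]
  simp only [Finset.univ_unique, Fin.default_eq_zero, Finset.sum_singleton]
  congr 1
  change E _ = E _
  congr 1
  funext i
  simp [Subsingleton.elim i 0]

theorem Cochain.toEnd_injective : Injective (Cochain.toEnd (K := K) (A := A)) := by
  intro D E h
  ext x
  have := LinearMap.congr_fun h (x 0)
  have hx : x = fun _ => x 0 := by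
    funext i; rw [Subsingleton.elim i 0]
  rw [hx]
  exact this

theorem bracketOne_jacobi {n : ℕ} (D E : Cochain K A 1) (f : Cochain K A n) :
    bracketOne K A n (bracketOne K A 1 D E) f =
      bracketOne K A n D (bracketOne K A n E f) - bracketOne K A n E (bracketOne K A n D f) := by
  ext x
  have key : ∀ P Q : Module.End K A,
      ∑ i : Fin n, ∑ j : Fin n, f (update (update x i (P (x i))) j (Q (update x i (P (x i)) j))) =
        ∑ i : Fin n, f (update x i (Q (P (x i)))) +
        ∑ i : Fin n, ∑ j : Fin n, if j = i then 0 else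
          f (update (update x i (P (x i))) j (Q (x j))) := by
    intro P Q
    rw [← Finset.sum_add_distrib]
    refine Finset.sum_congr rfl fun i _ => ?_
    rw [← Finset.sum_erase_add _ _ (Finset.mem_univ i),
      ← Finset.sum_erase_add _ (fun j => if j = i then 0 else
          f (update (update x i (P (x i))) j (Q (x j)))) (Finset.mem_univ i)]
    simp only [update_self, update_idem, if_true, add_zero]
    rw [add_comm]
    congr 1
    refine Finset.sum_congr rfl fun j hj => ?_
    have hj' : j ≠ i := Finset.ne_of_mem_erase hj
    rw [if_neg hj', update_of_ne hj']
  have comm : ∀ P Q : Module.End K A,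
      (∑ i : Fin n, ∑ j : Fin n, if j = i then 0 else
          f (update (update x i (P (x i))) j (Q (x j)))) =
      ∑ i : Fin n, ∑ j : Fin n, if j = i then 0 else
          f (update (update x i (Q (x i))) j (P (x j))) := by
    intro P Q
    rw [Finset.sum_comm]
    refine Finset.sum_congr rfl fun i _ => Finset.sum_congr rfl fun j _ => ?_
    by_cases h : i = j
    · simp [h]
    · rw [if_neg h, if_neg (Ne.symm h), update_comm h]
  simp only [bracketOne_apply, sub_apply, toEnd_bracketOne, map_sub, map_sum,
    MultilinearMap.map_update_sub, Finset.sum_sub_distrib, key]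
  rw [comm D.toEnd E.toEnd]
  abel

theorem mem_cocycles_one_iff {D : Cochain K A 1} :
    D ∈ cocycles K A 1 ↔ ∀ a b : A, D.toEnd (a * b) = a * D.toEnd b + D.toEnd a * b := by
  have key : ∀ x : Fin 2 → A, delta K A 1 D x =
      x 0 * D.toEnd (x 1) - D.toEnd (x 0 * x 1) + D.toEnd (x 0) * x 1 := by
    intro x
    have e1 : (Fin.tail x : Fin 1 → A) = fun _ => x 1 := by
      funext i; rw [Subsingleton.elim i 0]; rfl
    have e2 : (Fin.init x : Fin 1 → A) = fun _ => x 0 := by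
      funext i; rw [Subsingleton.elim i 0]; rfl
    have e3 : (Fin.contractNth (Fin.castSucc (0 : Fin 1)) (· * ·) x : Fin 1 → A) =
        fun _ => x 0 * x 1 := by
      funext i; rw [Subsingleton.elim i 0]; rfl
    rw [delta_apply]
    simp only [Finset.univ_unique, Fin.default_eq_zero, Finset.sum_singleton]
    rw [e1, e2, e3]
    simp [Cochain.toEnd, sub_eq_add_neg]
  rw [cocycles, LinearMap.mem_ker]
  constructor
  · intro h a b
    have h1 := key ![a, b]
    rw [h] at h1
    simp only [zero_apply, Matrix.cons_val_zero, Matrix.cons_val_one] at h1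
    rw [eq_comm, ← sub_eq_zero, h1]
    abel
  · intro h
    ext x
    rw [key, h]
    simp

theorem delta_bracketOne {n : ℕ} {D : Cochain K A 1} (hD : D ∈ cocycles K A 1)
    (f : Cochain K A n) :
    delta K A n (bracketOne K A n D f) = bracketOne K A (n + 1) D (delta K A n f) := by
  rw [mem_cocycles_one_iff] at hD
  ext x
  have hc : ∀ i : Fin n,
      ∑ l : Fin (n + 1), f (Fin.contractNth i.castSucc (· * ·) (update x l (D.toEnd (x l)))) =
      ∑ j : Fin n, f (update (Fin.contractNth i.castSucc (· * ·) x) j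
        (D.toEnd (Fin.contractNth i.castSucc (· * ·) x j))) := by
    intro i
    have hi : Fin.contractNth i.castSucc (· * ·) x i = x i.castSucc * x i.succ :=
      Fin.contractNth_apply_of_eq _ _ _ _ rfl
    rw [Fin.sum_univ_succAbove _ i.castSucc, ← Finset.add_sum_erase _ _ (Finset.mem_univ i),
      ← Finset.add_sum_erase (a := i) (f := fun j : Fin n => f (update
        (Fin.contractNth i.castSucc (· * ·) x) j
        (D.toEnd (Fin.contractNth i.castSucc (· * ·) x j)))) _ (Finset.mem_univ i),
      ← add_assoc]
    congr 1
    · rw [hi, hD, MultilinearMap.map_update_add, add_comm]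
      congr 2
      · funext j
        by_cases hj : j = i
        · subst hj
          rw [Fin.succAbove_castSucc_self]
          simp [Fin.contractNth, Fin.ext_iff]
        · have hj' : (j : ℕ) ≠ i := fun e => hj (Fin.ext e)
          simp only [Fin.contractNth, update_apply, Fin.ext_iff, Fin.val_castSucc, Fin.val_succ,
            Fin.succAbove_castSucc_self]
          split_ifs <;> first | rfl | omega
      · funext j
        by_cases hj : j = i
        · subst hj
          simp [Fin.contractNth, Fin.ext_iff]
        · have hj' : (j : ℕ) ≠ i := fun e => hj (Fin.ext e)
          simp only [Fin.contractNth, update_apply, Fin.ext_iff, Fin.val_castSucc, Fin.val_succ]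
          split_ifs <;> first | rfl | omega
    · refine Finset.sum_congr rfl fun j hj => ?_
      have hji : j ≠ i := Finset.ne_of_mem_erase hj
      have hj' : (j : ℕ) ≠ i := fun e => hji (Fin.ext e)
      congr 1
      rw [Fin.contractNth_apply_of_ne _ _ _ _ (by simpa using hj'.symm)]
      funext r
      rcases lt_or_gt_of_ne hj' with h | h
      · rw [Fin.succAbove_of_castSucc_lt _ _ (Fin.castSucc_lt_castSucc_iff.2 (Fin.lt_def.2 h))]
        simp only [Fin.contractNth, update_apply, Fin.ext_iff, Fin.val_castSucc, Fin.val_succ]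
        split_ifs <;> first | rfl | omega
      · rw [Fin.succAbove_of_le_castSucc _ _ (Fin.castSucc_le_castSucc_iff.2 (Fin.le_def.2 h.le))]
        simp only [Fin.contractNth, update_apply, Fin.ext_iff, Fin.val_castSucc, Fin.val_succ]
        split_ifs <;> first | rfl | omega
  have hl : ∑ l : Fin (n + 1), update x l (D.toEnd (x l)) 0 *
      f (Fin.tail (update x l (D.toEnd (x l)))) = D.toEnd (x 0) * f (Fin.tail x) +
        x 0 * ∑ j : Fin n, f (update (Fin.tail x) j (D.toEnd (Fin.tail x j))) := by
    rw [Fin.sum_univ_succ, Finset.mul_sum]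
    simp only [update_self, Fin.tail_update_zero, Fin.tail_update_succ]
    congr 1
  have hr : ∑ l : Fin (n + 1), f (Fin.init (update x l (D.toEnd (x l)))) *
      update x l (D.toEnd (x l)) (Fin.last n) =
        (∑ j : Fin n, f (update (Fin.init x) j (D.toEnd (Fin.init x j)))) * x (Fin.last n) +
        f (Fin.init x) * D.toEnd (x (Fin.last n)) := by
    rw [Fin.sum_univ_castSucc, Finset.sum_mul]
    simp only [update_self, Fin.init_update_last, Fin.init_update_castSucc]
    congr 1
    refine Finset.sum_congr rfl fun j _ => ?_
    rw [update_of_ne (Fin.castSucc_lt_last j).ne']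
    rfl
  rw [bracketOne_apply]
  simp only [delta_apply, bracketOne_apply, Finset.sum_add_distrib, ← Finset.smul_sum, hl, hr]
  rw [Finset.sum_comm]
  simp only [← Finset.smul_sum, hc, map_add, map_sum, map_smul, hD, smul_sub,
    Finset.sum_sub_distrib, mul_sub, sub_mul, smul_add]
  abel

theorem bracketOne_mem_cocycles {n : ℕ} {D : Cochain K A 1} (hD : D ∈ cocycles K A 1)
    {f : Cochain K A n} (hf : f ∈ cocycles K A n) :
    bracketOne K A n D f ∈ cocycles K A n := by
  have hf' : delta K A n f = 0 := hf
  change delta K A n _ = 0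
  rw [delta_bracketOne hD, hf', map_zero]

theorem bracketOne_mem_coboundaries {n : ℕ} {D : Cochain K A 1} (hD : D ∈ cocycles K A 1)
    {f : Cochain K A n} (hf : f ∈ coboundaries K A n) :
    bracketOne K A n D f ∈ coboundaries K A n := by
  cases n with
  | zero =>
    have hf' : f = 0 := hf
    rw [hf', map_zero]
    exact Submodule.zero_mem _
  | succ n =>
    obtain ⟨e, rfl⟩ := hf
    exact ⟨bracketOne K A n D e, delta_bracketOne hD e⟩

/-- The Gerstenhaber bracket `Z¹ × Zⁿ → Zⁿ` on cocycles. -/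
def bracketCocycles (K A : Type*) [CommRing K] [Ring A] [Algebra K A] (n : ℕ) :
    cocycles K A 1 →ₗ[K] Module.End K (cocycles K A n) :=
  LinearMap.mk₂ K (fun D f => ⟨bracketOne K A n D f, bracketOne_mem_cocycles D.2 f.2⟩)
    (fun D E f => Subtype.ext (by simp))
    (fun c D f => Subtype.ext (by simp))
    (fun D f g => Subtype.ext (by simp))
    (fun c D f => Subtype.ext (by simp))

/-- The Gerstenhaber bracket `Z¹ × HHⁿ → HHⁿ`. -/
def bracketQuot (K A : Type*) [CommRing K] [Ring A] [Algebra K A] (n : ℕ) :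
    cocycles K A 1 →ₗ[K] Module.End K (HH K A n) where
  toFun D := HH.lift (HH.mk K A n ∘ₗ bracketCocycles K A n D)
    (fun _ hf => HH.mk_eq_zero.2 (bracketOne_mem_coboundaries D.2 hf))
  map_add' D E := by
    ext ξ
    obtain ⟨f, rfl⟩ := HH.mk_surjective n ξ
    simp [HH.lift_mk]
  map_smul' c D := by
    ext ξ
    obtain ⟨f, rfl⟩ := HH.mk_surjective n ξ
    simp [HH.lift_mk]

end General

section Commutative

variable {K A : Type*} [CommRing K] [CommRing A] [Algebra K A]

theorem coboundaries_one : coboundaries K A 1 = ⊥ := by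
  rw [eq_bot_iff]
  rintro _ ⟨f, rfl⟩
  change delta K A 0 f = 0
  ext x
  have e : (Fin.init x : Fin 0 → A) = Fin.tail x := Subsingleton.elim _ _
  have e' : (Fin.last 0 : Fin 1) = 0 := rfl
  rw [delta_apply, e, e']
  simp [mul_comm]

/-- The Gerstenhaber bracket `HH¹ × HHⁿ → HHⁿ` of a commutative algebra. -/
def bracketHH (K A : Type*) [CommRing K] [CommRing A] [Algebra K A] (n : ℕ) :
    HH K A 1 →ₗ[K] Module.End K (HH K A n) :=
  HH.lift (bracketQuot K A n) (by
    intro D hD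
    rw [coboundaries_one, Submodule.mem_bot] at hD
    have : D = 0 := Subtype.ext hD
    rw [this, map_zero])

theorem bracketHH_mk {n : ℕ} (D : cocycles K A 1) (f : cocycles K A n) :
    bracketHH K A n (HH.mk K A 1 D) (HH.mk K A n f) = HH.mk K A n (bracketCocycles K A n D f) :=
  rfl

theorem bracketCocycles_coe {n : ℕ} (D : cocycles K A 1) (f : cocycles K A n) :
    (bracketCocycles K A n D f : Cochain K A n) =
      bracket (add_comm n 1) (D : Cochain K A 1) (f : Cochain K A n) :=
  rfl

theorem bracket_leibniz {n : ℕ} (D E : HH K A 1) (ξ : HH K A n) :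
    bracketHH K A n D (bracketHH K A n E ξ) =
      bracketHH K A n (bracketHH K A 1 D E) ξ + bracketHH K A n E (bracketHH K A n D ξ) := by
  obtain ⟨D, rfl⟩ := HH.mk_surjective _ D
  obtain ⟨E, rfl⟩ := HH.mk_surjective _ E
  obtain ⟨f, rfl⟩ := HH.mk_surjective _ ξ
  simp only [bracketHH_mk, ← map_add]
  congr 1
  apply Subtype.ext
  change bracketOne K A n D (bracketOne K A n E f) =
    bracketOne K A n (bracketOne K A 1 D E) f + bracketOne K A n E (bracketOne K A n D f)
  rw [bracketOne_jacobi]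
  abel

/-- `HH¹(A)` with the Gerstenhaber bracket is a Lie ring. -/
instance : LieRing (HH K A 1) where
  bracket D E := bracketHH K A 1 D E
  add_lie D E ξ := by
    change bracketHH K A 1 _ _ = bracketHH K A 1 _ _ + bracketHH K A 1 _ _
    simp
  lie_add D ξ η := by
    change bracketHH K A 1 _ _ = bracketHH K A 1 _ _ + bracketHH K A 1 _ _
    simp
  lie_self D := by
    obtain ⟨D, rfl⟩ := HH.mk_surjective _ D
    change bracketHH K A 1 _ _ = 0
    rw [bracketHH_mk]
    have : bracketCocycles K A 1 D D = 0 := by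
      apply Subtype.ext
      apply Cochain.toEnd_injective
      ext a
      change (bracketOne K A 1 D D).toEnd a = 0
      rw [toEnd_bracketOne, sub_self]
    rw [this, map_zero]
  leibniz_lie D E ξ := bracket_leibniz D E ξ

/-- `HH¹(A)` with the Gerstenhaber bracket is a Lie algebra. -/
instance : LieAlgebra K (HH K A 1) where
  lie_smul c D ξ := map_smul (bracketHH K A 1 D) c ξ

/-- `HHⁿ(A)` is a Lie module over `HH¹(A)` by the Gerstenhaber bracket. -/
instance (n : ℕ) : LieRingModule (HH K A 1) (HH K A n) where
  bracket D ξ := bracketHH K A n D ξ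
  add_lie D E ξ := by
    simp
  lie_add D ξ η := by
    simp
  leibniz_lie D E ξ := bracket_leibniz D E ξ

instance (n : ℕ) : LieModule K (HH K A 1) (HH K A n) where
  smul_lie c D ξ := by
    change bracketHH K A n _ _ = c • bracketHH K A n _ _
    simp
  lie_smul c D ξ := map_smul (bracketHH K A n D) c ξ

theorem lie_def {n : ℕ} (D : HH K A 1) (ξ : HH K A n) : ⁅D, ξ⁆ = bracketHH K A n D ξ :=
  rfl

end Commutative

end Hochschild

/-!
Multiplication by `(y₁ ⋯ yₙ)⁻¹` identifies the Hochschild cochains of `A = K[G]` with the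
inhomogeneous group cochains `Gⁿ → A` for the trivial action. Given a generator `g`, the map
`φ ↦ ∑ z, φ(g, z, ·)` lowers degrees by two and is inverse up to homotopy to the cup product with
the `2`-cocycle of carries in the addition of discrete logarithms. As `|G| = 0` in `K`, it follows
that `HHⁿ(A)` is free of rank one over `A`, generated by the class `cₙ` of `carryᵏ` if `n = 2 k` and
of `carryᵏ ∪ log` if `n = 2 k + 1`.

Every derivation of `A` is a multiple `a E` of the Euler derivation `E(y) = log(y) y`. The bracket
satisfies `[D, b cₙ] = D(b) cₙ + b [D, cₙ]`, and `[a E, cₙ]` is `0` for even `n` and `-E(a) cₙ` for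
odd `n`. Hence `b cₙ ↦ b` is an isomorphism with the standard module for even `n`, and `b cₙ ↦ b E`
is an isomorphism with the adjoint module for odd `n`.
-/

open scoped MonoidAlgebra

namespace GroupCochain

open Finset

/-! ### Inhomogeneous cochains -/

section Differential

variable {G M : Type*} [AddCommGroup M]

/-- The cochain `φ(x, ·)`, one degree lower. -/
def slice {n : ℕ} (φ : (Fin (n + 1) → G) → M) (x : G) : (Fin n → G) → M :=
  fun y => φ (Fin.cons x y)

theorem exists_eq_cons_cons {n : ℕ} (y : Fin (n + 2) → G) :
    ∃ a b w, y = Fin.cons a (Fin.cons b w) :=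
  ⟨y 0, Fin.tail y 0, Fin.tail (Fin.tail y), by simp only [Fin.cons_self_tail]⟩

theorem init_cons {n : ℕ} (x : G) (y : Fin (n + 1) → G) :
    (Fin.init (Fin.cons x y : Fin (n + 2) → G) : Fin (n + 1) → G) = Fin.cons x (Fin.init y) := by
  funext j
  cases j using Fin.cases <;> rfl

variable [Mul G]

theorem contractNth_zero_cons {n : ℕ} (x : G) (y : Fin (n + 1) → G) :
    Fin.contractNth (0 : Fin (n + 1)).castSucc (· * ·) (Fin.cons x y : Fin (n + 2) → G) =
      Fin.cons (x * y 0) (Fin.tail y) := by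
  funext j
  cases j using Fin.cases <;> simp [Fin.contractNth, Fin.tail]

theorem contractNth_succ_cons {n : ℕ} (i : Fin n) (x : G) (y : Fin (n + 1) → G) :
    Fin.contractNth i.succ.castSucc (· * ·) (Fin.cons x y : Fin (n + 2) → G) =
      Fin.cons x (Fin.contractNth i.castSucc (· * ·) y) := by
  funext j
  cases j using Fin.cases <;> simp [Fin.contractNth]

variable (R : Type*) [Ring R] [Module R M]

/-- The differential of the inhomogeneous cochain complex `(Gⁿ → M)ₙ`, where `G` acts trivially
on `M`. -/
def d {n : ℕ} : ((Fin n → G) → M) →ₗ[R] (Fin (n + 1) → G) → M :=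
  LinearMap.funLeft R M (Fin.tail (α := fun _ => G)) +
    ∑ i : Fin n, (-1 : ℤ) ^ ((i : ℕ) + 1) •
      LinearMap.funLeft R M (Fin.contractNth (α := G) i.castSucc (· * ·)) +
    (-1 : ℤ) ^ (n + 1) • LinearMap.funLeft R M (Fin.init (α := fun _ => G))

theorem d_apply {n : ℕ} (φ : (Fin n → G) → M) (y : Fin (n + 1) → G) :
    d R φ y = φ (Fin.tail y) +
      ∑ i : Fin n, (-1 : ℤ) ^ ((i : ℕ) + 1) • φ (Fin.contractNth i.castSucc (· * ·) y) +
      (-1 : ℤ) ^ (n + 1) • φ (Fin.init y) := by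
  simp [d, LinearMap.funLeft_apply]

theorem d_cons {n : ℕ} (φ : (Fin (n + 1) → G) → M) (x : G) (y : Fin (n + 1) → G) :
    d R φ (Fin.cons x y) =
      φ y - φ (Fin.cons (x * y 0) (Fin.tail y)) + φ (Fin.cons x (Fin.tail y)) -
        d R (slice φ x) y := by
  simp only [d_apply, slice, Fin.tail_cons, init_cons, Fin.sum_univ_succ, contractNth_zero_cons,
    contractNth_succ_cons, Fin.val_zero, Fin.val_succ, pow_succ, pow_zero, mul_neg, mul_one,
    neg_neg, neg_smul, sum_neg_distrib, one_smul]
  abel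

theorem d_cons_cons {n : ℕ} (φ : (Fin (n + 2) → G) → M) (x y : G) (w : Fin (n + 1) → G) :
    d R φ (Fin.cons x (Fin.cons y w)) =
      φ (Fin.cons y w) - φ (Fin.cons (x * y) w) +
        φ (Fin.cons x (Fin.cons (y * w 0) (Fin.tail w))) -
        φ (Fin.cons x (Fin.cons y (Fin.tail w))) + d R (slice (slice φ x) y) w := by
  simp only [d_cons, Fin.cons_zero, Fin.tail_cons, slice]
  abel

theorem d_eq_zero_of_degree_zero (φ : (Fin 0 → G) → M) : d R φ = 0 := by
  funext y
  have h : (Fin.init y : Fin 0 → G) = Fin.tail y := Subsingleton.elim _ _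
  simp [d_apply, h]

end Differential

section Cocycle

variable {G M : Type*} [Monoid G] [AddCommGroup M] {R : Type*} [Ring R] [Module R M]
  {n : ℕ} {φ : (Fin (n + 1) → G) → M}

theorem apply_cons_mul_of_d_eq_zero (hφ : d R φ = 0) (x y : G) (w : Fin n → G) :
    φ (Fin.cons (x * y) w) =
      φ (Fin.cons y w) + φ (Fin.cons x w) - d R (slice φ x) (Fin.cons y w) := by
  have h := congrFun hφ (Fin.cons x (Fin.cons y w))
  simp only [d_cons R φ, Fin.cons_zero, Fin.tail_cons, Pi.zero_apply] at h
  rw [← sub_eq_zero, ← neg_eq_zero, ← h]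
  abel

theorem apply_cons_one_of_d_eq_zero (hφ : d R φ = 0) (x : G) (w : Fin n → G) :
    φ (Fin.cons 1 w) = d R (slice φ 1) (Fin.cons x w) := by
  have h := apply_cons_mul_of_d_eq_zero hφ 1 x w
  rwa [one_mul, add_sub_assoc, left_eq_add, sub_eq_zero] at h

theorem apply_cons_pow_of_d_eq_zero (hφ : d R φ = 0) (x : G) (w : Fin n → G) (m : ℕ) :
    φ (Fin.cons (x ^ m) w) = φ (Fin.cons 1 w) + m • φ (Fin.cons x w) -
      ∑ j ∈ range m, d R (slice φ x) (Fin.cons (x ^ j) w) := by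
  induction m with
  | zero => simp
  | succ m ih =>
    rw [pow_succ', apply_cons_mul_of_d_eq_zero hφ, ih, sum_range_succ, succ_nsmul]
    abel

end Cocycle

/-! ### Discrete logarithms -/

section DiscreteLog

variable {G : Type*} [CommGroup G] {g : G} (hg : ∀ x, x ∈ Subgroup.zpowers g)

/-- The discrete logarithm of `y` to the base of a generator `g` of `G`; it lies in
`{0, …, |G| - 1}` when `G` is finite. -/
noncomputable def discreteLog (y : G) : ℕ :=
  ((zmodMulEquivOfGenerator hg rfl).symm y).toAdd.val

theorem discreteLog_pow (m : ℕ) : discreteLog hg (g ^ m) = m % Nat.card G := by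
  have h := zmodMulEquivOfGenerator_symm_apply_zpow hg rfl m
  rw [zpow_natCast, Int.cast_natCast] at h
  rw [discreteLog, h, toAdd_ofAdd, ZMod.val_natCast]

theorem discreteLog_one : discreteLog hg 1 = 0 := by
  simpa only [pow_zero, Nat.zero_mod] using discreteLog_pow hg 0

variable [Finite G]

theorem discreteLog_lt (y : G) : discreteLog hg y < Nat.card G :=
  have : NeZero (Nat.card G) := ⟨Nat.card_pos.ne'⟩
  ZMod.val_lt _

theorem zmodMulEquivOfGenerator_ofAdd (i : ZMod (Nat.card G)) :
    zmodMulEquivOfGenerator hg rfl (Multiplicative.ofAdd i) = g ^ i.val := by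
  have : NeZero (Nat.card G) := ⟨Nat.card_pos.ne'⟩
  have h := zmodMulEquivOfGenerator_apply_ofAdd_intCast hg rfl i.val
  rwa [Int.cast_natCast, ZMod.natCast_zmod_val, zpow_natCast] at h

theorem pow_discreteLog (y : G) : g ^ discreteLog hg y = y := by
  rw [discreteLog, ← zmodMulEquivOfGenerator_ofAdd hg, ofAdd_toAdd, MulEquiv.apply_symm_apply]

theorem discreteLog_generator [Nontrivial G] : discreteLog hg g = 1 := by
  simpa only [pow_one, Nat.mod_eq_of_lt Finite.one_lt_card] using discreteLog_pow hg 1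

/-- The carry in the addition of the discrete logarithms of `y` and `z` modulo `|G|`. As a
function of `(y, z)` it is a `2`-cocycle. -/
noncomputable def carry (y z : G) : ℕ :=
  if Nat.card G ≤ discreteLog hg y + discreteLog hg z then 1 else 0

theorem discreteLog_mul_add_card_mul_carry (y z : G) :
    discreteLog hg (y * z) + Nat.card G * carry hg y z = discreteLog hg y + discreteLog hg z := by
  have hmod : discreteLog hg (y * z) = (discreteLog hg y + discreteLog hg z) % Nat.card G := by
    rw [← discreteLog_pow hg, pow_add, pow_discreteLog, pow_discreteLog]
  have hy := discreteLog_lt hg y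
  have hz := discreteLog_lt hg z
  rw [hmod, carry]
  split_ifs with hc
  · rw [Nat.mod_eq_sub_mod hc, Nat.mod_eq_of_lt (by omega)]
    omega
  · rw [Nat.mod_eq_of_lt (by omega), mul_zero, add_zero]

theorem carry_add_carry_mul (x y z : G) :
    carry hg y z + carry hg x (y * z) = carry hg (x * y) z + carry hg x y := by
  have hxy := discreteLog_mul_add_card_mul_carry hg x y
  have hyz := discreteLog_mul_add_card_mul_carry hg y z
  have hxy_z := discreteLog_mul_add_card_mul_carry hg (x * y) z
  have hx_yz := discreteLog_mul_add_card_mul_carry hg x (y * z)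
  rw [← mul_assoc] at hx_yz
  apply Nat.eq_of_mul_eq_mul_left (Nat.card_pos (α := G))
  rw [mul_add, mul_add]
  omega

theorem carry_generator [Nontrivial G] (z : G) [Decidable (z = g⁻¹)] :
    carry hg g z = if z = g⁻¹ then 1 else 0 := by
  have hlt := discreteLog_lt hg z
  have hz : z = g⁻¹ ↔ Nat.card G ∣ discreteLog hg z + 1 := by
    rw [← orderOf_eq_card_of_forall_mem_zpowers hg, orderOf_dvd_iff_pow_eq_one, pow_succ,
      pow_discreteLog, eq_inv_iff_mul_eq_one]
  have hle : Nat.card G ∣ discreteLog hg z + 1 ↔ Nat.card G ≤ 1 + discreteLog hg z :=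
    ⟨fun h => (Nat.le_of_dvd (by omega) h).trans (by omega), fun h => ⟨1, by omega⟩⟩
  simp only [carry, discreteLog_generator, hz, hle]

theorem discreteLog_mul_smul {M : Type*} [AddCommMonoid M] (hM : ∀ m : M, Nat.card G • m = 0)
    (y z : G) (m : M) :
    discreteLog hg (y * z) • m = discreteLog hg y • m + discreteLog hg z • m := by
  rw [← add_smul, ← discreteLog_mul_add_card_mul_carry, add_smul, mul_smul, hM, add_zero]

theorem discreteLog_smul_add_discreteLog_inv_smul {M : Type*} [AddCommMonoid M]
    (hM : ∀ m : M, Nat.card G • m = 0) (y : G) (m : M) :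
    discreteLog hg y • m + discreteLog hg y⁻¹ • m = 0 := by
  rw [← discreteLog_mul_smul hg hM, mul_inv_cancel, discreteLog_one, zero_smul]

end DiscreteLog

section DiscreteLogSum

theorem sum_apply_mul_left {G M : Type*} [Group G] [Fintype G] [AddCommMonoid M] (x : G)
    (ψ : G → M) : ∑ z, ψ (x * z) = ∑ z, ψ z :=
  Equiv.sum_comp (Equiv.mulLeft x) ψ

theorem sum_range_card_pow {G M : Type*} [CommGroup G] [Fintype G] [AddCommMonoid M] {g : G}
    (hg : ∀ x, x ∈ Subgroup.zpowers g) (ψ : G → M) :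
    ∑ j ∈ range (Nat.card G), ψ (g ^ j) = ∑ z, ψ z :=
  sum_nbij' (g ^ ·) (discreteLog hg) (by simp) (fun z _ => mem_range.2 (discreteLog_lt hg z))
    (fun j hj => by rw [discreteLog_pow, Nat.mod_eq_of_lt (mem_range.1 hj)])
    (fun z _ => pow_discreteLog hg z) (by simp)

variable {G M : Type*} [CommGroup G] {g : G} (hg : ∀ x, x ∈ Subgroup.zpowers g) [Fintype G]
  [AddCommMonoid M]

theorem sum_carry (y : G) : ∑ z, carry hg y z = discreteLog hg y := by
  have hsum : ∑ z, (discreteLog hg (y * z) + Nat.card G * carry hg y z) =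
      ∑ z, (discreteLog hg y + discreteLog hg z) :=
    sum_congr rfl fun z _ => discreteLog_mul_add_card_mul_carry hg y z
  rw [sum_add_distrib, sum_add_distrib, sum_apply_mul_left, ← mul_sum,
    sum_const, card_univ, smul_eq_mul, ← Nat.card_eq_fintype_card, add_comm] at hsum
  exact Nat.eq_of_mul_eq_mul_left Nat.card_pos (Nat.add_right_cancel hsum)

theorem sum_range_discreteLog_mul (ψ : G → M) (y z : G) :
    ∑ j ∈ range (discreteLog hg z), ψ (g ^ j) + ∑ j ∈ range (discreteLog hg y), ψ (g ^ j * z) =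
      ∑ j ∈ range (discreteLog hg (y * z)), ψ (g ^ j) + carry hg y z • ∑ w, ψ w := by
  have hshift (x : G) (j : ℕ) : g ^ (discreteLog hg x + j) = x * g ^ j := by
    rw [pow_add, pow_discreteLog]
  have hleft : ∑ j ∈ range (discreteLog hg z + discreteLog hg y), ψ (g ^ j) =
      ∑ j ∈ range (discreteLog hg z), ψ (g ^ j) +
        ∑ j ∈ range (discreteLog hg y), ψ (g ^ j * z) := by
    simp only [sum_range_add, hshift, mul_comm z]
  rw [← hleft, add_comm (discreteLog hg z), ← discreteLog_mul_add_card_mul_carry hg y z,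
    sum_range_add, carry]
  split_ifs
  · simp only [mul_one, one_smul, hshift]
    rw [sum_range_card_pow hg fun w => ψ (y * z * w), sum_apply_mul_left]
  · simp

end DiscreteLogSum

/-! ### Periodicity -/

section CupCarry

variable {G M : Type*} [CommGroup G] [AddCommGroup M] (R : Type*) [Ring R] [Module R M]
  {g : G} (hg : ∀ x, x ∈ Subgroup.zpowers g) {n : ℕ}

/-- The cup product of the carry cocycle with an `n`-cochain. -/
noncomputable def cupCarry : ((Fin n → G) → M) →ₗ[R] (Fin (n + 2) → G) → M where
  toFun φ y := carry hg (y 0) (y 1) • φ (Fin.tail (Fin.tail y))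
  map_add' _ _ := funext fun _ => smul_add _ _ _
  map_smul' c _ := funext fun _ => smul_comm _ c _

theorem cupCarry_cons_cons (φ : (Fin n → G) → M) (x y : G) (w : Fin n → G) :
    cupCarry R hg φ (Fin.cons x (Fin.cons y w)) = carry hg x y • φ w :=
  rfl

theorem d_cupCarry [Finite G] (φ : (Fin n → G) → M) :
    d R (cupCarry R hg φ) = cupCarry R hg (d R φ) := by
  funext y
  obtain ⟨a, b, w, rfl⟩ := exists_eq_cons_cons y
  obtain ⟨c, v, rfl⟩ : ∃ c v, w = Fin.cons c v := ⟨w 0, Fin.tail w, (Fin.cons_self_tail w).symm⟩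
  have hslice : slice (slice (cupCarry R hg φ) a) b = carry hg a b • φ := rfl
  have hcocycle := congrArg (· • φ v) (carry_add_carry_mul hg a b c)
  simp only [add_smul] at hcocycle
  simp only [d_cons_cons, hslice, map_nsmul, Pi.smul_apply, cupCarry_cons_cons, Fin.cons_zero,
    Fin.tail_cons]
  rw [add_eq_right, sub_add_eq_add_sub, hcocycle]
  abel

end CupCarry

section Lower

variable {G M : Type*} [Fintype G] [AddCommGroup M] (R : Type*) [Ring R] [Module R M] (g : G)
  {n : ℕ}

/-- The map `φ ↦ ∑ z, φ(g, z, ·)` of degree `-2` on cochains. For a generator `g` it inverts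
`cupCarry` on cohomology. -/
def lower : ((Fin (n + 2) → G) → M) →ₗ[R] (Fin n → G) → M :=
  ∑ z, LinearMap.funLeft R M fun y => Fin.cons g (Fin.cons z y)

theorem lower_eq_sum (φ : (Fin (n + 2) → G) → M) :
    lower R g φ = ∑ z, slice (slice φ g) z := by
  simp only [lower, LinearMap.sum_apply]
  rfl

theorem lower_apply (φ : (Fin (n + 2) → G) → M) (y : Fin n → G) :
    lower R g φ y = ∑ z, φ (Fin.cons g (Fin.cons z y)) := by
  rw [lower_eq_sum, Finset.sum_apply]
  rfl

variable [CommGroup G]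

theorem lower_d (φ : (Fin (n + 2) → G) → M) : lower R g (d R φ) = d R (lower R g φ) := by
  funext w
  have hmul : ∑ z, φ (Fin.cons g (Fin.cons (z * w 0) (Fin.tail w))) =
      ∑ z, φ (Fin.cons g (Fin.cons z (Fin.tail w))) := by
    simp only [mul_comm _ (w 0)]
    exact sum_apply_mul_left (w 0) fun z => φ (Fin.cons g (Fin.cons z (Fin.tail w)))
  rw [lower_apply, lower_eq_sum, map_sum, Finset.sum_apply]
  simp only [d_cons_cons, sum_add_distrib, sum_sub_distrib, hmul,
    sum_apply_mul_left g fun z => φ (Fin.cons z w)]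
  abel

theorem lower_d_of_degree_one (hM : ∀ m : M, Nat.card G • m = 0) (φ : (Fin 1 → G) → M) :
    lower R g (d R φ) = 0 := by
  funext w
  rw [lower_apply]
  simp only [d_cons R φ, d_eq_zero_of_degree_zero, Fin.cons_zero, Fin.tail_cons, sum_add_distrib,
    sum_sub_distrib, sum_apply_mul_left g fun z => φ (Fin.cons z w), sum_const, card_univ,
    sub_self, zero_add, Pi.zero_apply, sub_zero]
  rw [← Nat.card_eq_fintype_card, hM]

end Lower

section Homotopy

variable {G M : Type*} [CommGroup G] [AddCommGroup M] {R : Type*} [Ring R] [Module R M]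
  {g : G} (hg : ∀ x, x ∈ Subgroup.zpowers g) {n : ℕ}

/-- The cochain `(a, w) ↦ ∑ ψ(gʲ, w)`, the sum being over `j < discreteLog a`. It provides the
homotopy between the identity and `cupCarry ∘ lower`. -/
noncomputable def partialSum (ψ : (Fin (n + 1) → G) → M) : (Fin (n + 1) → G) → M :=
  fun y => ∑ j ∈ range (discreteLog hg (y 0)), ψ (Fin.cons (g ^ j) (Fin.tail y))

theorem partialSum_cons (ψ : (Fin (n + 1) → G) → M) (a : G) (w : Fin n → G) :
    partialSum hg ψ (Fin.cons a w) =
      ∑ j ∈ range (discreteLog hg a), ψ (Fin.cons (g ^ j) w) :=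
  rfl

variable [Fintype G]

theorem d_partialSum_cons_cons (ψ : (Fin (n + 1) → G) → M) (a b : G) (w : Fin n → G) :
    d R (partialSum hg ψ) (Fin.cons a (Fin.cons b w)) =
      ∑ j ∈ range (discreteLog hg a), d R ψ (Fin.cons (g ^ j) (Fin.cons b w)) -
        discreteLog hg a • ψ (Fin.cons b w) + carry hg a b • ∑ z, ψ (Fin.cons z w) := by
  have hslice : slice (partialSum hg ψ) a =
      ∑ j ∈ range (discreteLog hg a), slice ψ (g ^ j) := by
    funext y
    rw [Finset.sum_apply]
    rfl
  have hcarry := sum_range_discreteLog_mul hg (fun z => ψ (Fin.cons z w)) a b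
  simp only [d_cons R, hslice, map_sum, Finset.sum_apply, Fin.cons_zero, Fin.tail_cons,
    partialSum_cons, sum_add_distrib, sum_sub_distrib, sum_const, card_range]
  rw [eq_sub_of_add_eq' hcarry.symm]
  abel

theorem eq_d_add_cupCarry_lower {φ : (Fin (n + 2) → G) → M} (hφ : d R φ = 0) :
    φ = d R (slice φ 1 - partialSum hg (slice φ g)) + cupCarry R hg (lower R g φ) := by
  funext y
  obtain ⟨a, b, w, rfl⟩ := exists_eq_cons_cons y
  calc φ (Fin.cons a (Fin.cons b w))
      = φ (Fin.cons (g ^ discreteLog hg a) (Fin.cons b w)) := by rw [pow_discreteLog]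
    _ = d R (slice φ 1) (Fin.cons a (Fin.cons b w)) +
          discreteLog hg a • φ (Fin.cons g (Fin.cons b w)) -
          ∑ j ∈ range (discreteLog hg a),
            d R (slice φ g) (Fin.cons (g ^ j) (Fin.cons b w)) := by
      rw [apply_cons_pow_of_d_eq_zero hφ, apply_cons_one_of_d_eq_zero hφ a]
    _ = _ := by
      rw [map_sub, Pi.add_apply, Pi.sub_apply, d_partialSum_cons_cons, cupCarry_cons_cons,
        lower_apply]
      simp only [slice]
      abel

end Homotopy

section Coboundaries

/-- Coboundaries of the complex of inhomogeneous cochains, `0` in degree zero. -/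
def coboundaries (G M R : Type*) [Mul G] [AddCommGroup M] [Ring R] [Module R M] :
    (n : ℕ) → Submodule R ((Fin n → G) → M)
  | 0 => ⊥
  | _ + 1 => LinearMap.range (d R)

variable {G M : Type*} [CommGroup G] [Finite G] [AddCommGroup M] {R : Type*} [Ring R] [Module R M]
  {g : G}

theorem cupCarry_mem_coboundaries (hg : ∀ x, x ∈ Subgroup.zpowers g) {n : ℕ}
    {φ : (Fin n → G) → M} (hφ : φ ∈ coboundaries G M R n) :
    cupCarry R hg φ ∈ coboundaries G M R (n + 2) := by
  cases n with
  | zero =>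
    rw [(Submodule.mem_bot R).1 hφ, map_zero]
    exact Submodule.zero_mem _
  | succ n =>
    obtain ⟨η, rfl⟩ := hφ
    exact ⟨cupCarry R hg η, d_cupCarry R hg η⟩

theorem eq_zero_of_d_eq_zero_of_degree_one (hg : ∀ x, x ∈ Subgroup.zpowers g)
    {φ : (Fin 1 → G) → M} (hφ : d R φ = 0) (hφg : φ ![g] = 0) : φ = 0 := by
  funext y
  obtain ⟨a, w, rfl⟩ : ∃ a w, y = Fin.cons a w := ⟨y 0, Fin.tail y, (Fin.cons_self_tail y).symm⟩
  have hw : (Fin.cons g w : Fin 1 → G) = ![g] := congrArg _ (Subsingleton.elim _ _)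
  rw [← pow_discreteLog hg a, apply_cons_pow_of_d_eq_zero hφ, apply_cons_one_of_d_eq_zero hφ 1, hw]
  simp only [d_eq_zero_of_degree_zero, hφg, Pi.zero_apply, smul_zero, sum_const_zero, add_zero,
    sub_zero]

end Coboundaries

section Evaluation

variable {G M : Type*} [Fintype G] [AddCommGroup M]

/-- Evaluation of `n`-cochains: `φ ↦ φ()` for `n = 0`, `φ ↦ φ(g)` for `n = 1`, extended to all `n`
by `lower`. For a generator `g` it identifies cohomology with `M` when `|G| M = 0`. -/
def ev (R : Type*) [Ring R] [Module R M] (g : G) : (n : ℕ) → ((Fin n → G) → M) →ₗ[R] M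
  | 0 => LinearMap.proj ![]
  | 1 => LinearMap.proj ![g]
  | n + 2 => ev R g n ∘ₗ lower R g

variable {R : Type*} [Ring R] [Module R M] {g : G}

theorem ev_mul_left {n : ℕ} (b : R) (φ : (Fin n → G) → R) :
    ev R g n (fun y => b * φ y) = b * ev R g n φ :=
  (ev R g n).map_smul b φ

variable [CommGroup G]

theorem ev_d (hM : ∀ m : M, Nat.card G • m = 0) :
    (n : ℕ) → (φ : (Fin n → G) → M) → ev R g (n + 1) (d R φ) = 0
  | 0, φ => by rw [d_eq_zero_of_degree_zero, map_zero]
  | 1, φ => by rw [ev, LinearMap.comp_apply, lower_d_of_degree_one R g hM, map_zero]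
  | n + 2, φ => by rw [ev, LinearMap.comp_apply, lower_d, ev_d hM n]

theorem ev_eq_zero_of_mem_coboundaries (hM : ∀ m : M, Nat.card G • m = 0) {n : ℕ}
    {φ : (Fin n → G) → M} (hφ : φ ∈ coboundaries G M R n) : ev R g n φ = 0 := by
  cases n with
  | zero => rw [(Submodule.mem_bot R).1 hφ, map_zero]
  | succ n =>
    obtain ⟨η, rfl⟩ := hφ
    exact ev_d hM n η

theorem mem_coboundaries_of_ev_eq_zero (hg : ∀ x, x ∈ Subgroup.zpowers g) : (n : ℕ) →
    (φ : (Fin n → G) → M) → d R φ = 0 → ev R g n φ = 0 → φ ∈ coboundaries G M R n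
  | 0, φ, _, hev => (Submodule.mem_bot R).2 <| funext fun y => by
    rw [Subsingleton.elim y ![]]
    exact hev
  | 1, φ, hφ, hev => by
    rw [eq_zero_of_d_eq_zero_of_degree_one hg hφ hev]
    exact Submodule.zero_mem _
  | n + 2, φ, hφ, hev => by
    have hlower : lower R g φ ∈ coboundaries G M R n :=
      mem_coboundaries_of_ev_eq_zero hg n _ (by rw [← lower_d, hφ, map_zero]) hev
    rw [eq_d_add_cupCarry_lower hg hφ]
    exact Submodule.add_mem _ ⟨_, rfl⟩ (cupCarry_mem_coboundaries hg hlower)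

end Evaluation

/-! ### Generating cocycles -/

section GeneratingCocycle

variable {G : Type*} [CommGroup G] {g : G} (hg : ∀ x, x ∈ Subgroup.zpowers g)

/-- The cocycle whose class generates `Hⁿ(G, R)` when `|G| = 0` in `R`: the power `carryᵏ` in
degree `2 k` and the cup product of `carryᵏ` with the discrete logarithm in degree `2 k + 1`. -/
noncomputable def generatingCocycle (R : Type*) [Ring R] : (n : ℕ) → (Fin n → G) → R
  | 0 => 1
  | 1 => fun y => discreteLog hg (y 0)
  | n + 2 => cupCarry R hg (generatingCocycle R n)

variable {R : Type*} [Ring R]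

theorem cast_discreteLog_mul [Finite G] (hR : (Nat.card G : R) = 0) (y z : G) :
    (discreteLog hg (y * z) : R) = discreteLog hg y + discreteLog hg z := by
  have h := congrArg (Nat.cast (R := R)) (discreteLog_mul_add_card_mul_carry hg y z)
  simpa only [Nat.cast_add, Nat.cast_mul, hR, zero_mul, add_zero] using h

theorem cast_discreteLog_prod [Finite G] (hR : (Nat.card G : R) = 0) {n : ℕ} (y : Fin n → G) :
    (discreteLog hg (∏ i, y i) : R) = ∑ i, (discreteLog hg (y i) : R) := by
  induction n with
  | zero => rw [Fin.prod_univ_zero, Fin.sum_univ_zero, discreteLog_one, Nat.cast_zero]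
  | succ n ih => rw [Fin.prod_univ_succ, Fin.sum_univ_succ, cast_discreteLog_mul hg hR, ih]

theorem d_generatingCocycle [Finite G] (hR : (Nat.card G : R) = 0) :
    (n : ℕ) → d R (generatingCocycle hg R n) = 0
  | 0 => d_eq_zero_of_degree_zero R _
  | 1 => by
    funext y
    obtain ⟨a, b, w, rfl⟩ := exists_eq_cons_cons y
    rw [d_cons, d_eq_zero_of_degree_zero]
    simp [generatingCocycle, cast_discreteLog_mul hg hR]
  | n + 2 => by rw [generatingCocycle, d_cupCarry, d_generatingCocycle hR n, map_zero]

variable [Fintype G] [Nontrivial G]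

theorem sum_carry_generator_smul {M : Type*} [AddCommMonoid M] (ψ : G → M) :
    ∑ z, carry hg g z • ψ z = ψ g⁻¹ := by
  classical
  simp only [carry_generator, ite_smul, one_smul, zero_smul, sum_ite_eq', mem_univ, if_true]

theorem lower_cupCarry {M : Type*} [AddCommGroup M] [Module R M] {n : ℕ} (φ : (Fin n → G) → M) :
    lower R g (cupCarry R hg φ) = φ := by
  funext y
  simp only [lower_apply, cupCarry_cons_cons]
  exact sum_carry_generator_smul hg fun _ => φ y

theorem ev_generatingCocycle : (n : ℕ) → ev R g n (generatingCocycle hg R n) = 1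
  | 0 => rfl
  | 1 => by
    change ((discreteLog hg g : ℕ) : R) = 1
    rw [discreteLog_generator, Nat.cast_one]
  | n + 2 => by
    rw [ev, generatingCocycle, LinearMap.comp_apply, lower_cupCarry, ev_generatingCocycle n]

end GeneratingCocycle

/-! ### Translation of arguments -/

section TranslationDefect

variable {G M : Type*} [CommGroup G] [AddCommGroup M] {g : G}
  (hg : ∀ x, x ∈ Subgroup.zpowers g)

/-- The failure of a cochain to be invariant under translation of one argument by `h`, summed over
all arguments with their discrete logarithms as weights. It measures the bracket of the derivation
`y ↦ discreteLog y • h y` with a cochain. -/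
noncomputable def translationDefect (h : G) {n : ℕ} (φ : (Fin n → G) → M) : (Fin n → G) → M :=
  fun y => ∑ l, discreteLog hg (y l) • (φ y - φ (Function.update y l (h * y l)))

theorem translationDefect_cons {n : ℕ} (h : G) (φ : (Fin (n + 1) → G) → M) (x : G)
    (w : Fin n → G) :
    translationDefect hg h φ (Fin.cons x w) =
      discreteLog hg x • (φ (Fin.cons x w) - φ (Fin.cons (h * x) w)) +
        translationDefect hg h (slice φ x) w := by
  simp only [translationDefect, slice, Fin.sum_univ_succ, Fin.cons_zero, Fin.cons_succ,
    Fin.update_cons_zero, ← Fin.cons_update]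

theorem translationDefect_nsmul {n : ℕ} (h : G) (k : ℕ) (φ : (Fin n → G) → M) :
    translationDefect hg h (k • φ) = k • translationDefect hg h φ := by
  funext y
  simp only [translationDefect, Pi.smul_apply, ← smul_sub, smul_sum]
  exact sum_congr rfl fun l _ => smul_comm _ _ _

variable (R : Type*) [Ring R]

theorem translationDefect_cupCarry_cons_cons [Module R M] (h : G) {n : ℕ} (φ : (Fin n → G) → M)
    (x z : G) (w : Fin n → G) :
    translationDefect hg h (cupCarry R hg φ) (Fin.cons x (Fin.cons z w)) =
      discreteLog hg x • (carry hg x z • φ w - carry hg (h * x) z • φ w) +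
        (discreteLog hg z • (carry hg x z • φ w - carry hg x (h * z) • φ w) +
          carry hg x z • translationDefect hg h φ w) := by
  have hslice : slice (slice (cupCarry R hg φ) x) z = carry hg x z • φ := rfl
  rw [translationDefect_cons, translationDefect_cons, hslice, translationDefect_nsmul]
  rfl

variable [Fintype G] [Nontrivial G]

theorem sum_carry_generator_mul_smul (h : G) (ψ : G → M) :
    ∑ z, carry hg g (h * z) • ψ z = ψ (h * g)⁻¹ := by
  have hshift := sum_apply_mul_left h fun z => carry hg g z • ψ (h⁻¹ * z)
  simp only [inv_mul_cancel_left] at hshift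
  rw [hshift, sum_carry_generator_smul, mul_inv]

theorem lower_translationDefect_cupCarry [Module R M] (hM : ∀ m : M, Nat.card G • m = 0) (h : G)
    {n : ℕ} (φ : (Fin n → G) → M) :
    lower R g (translationDefect hg h (cupCarry R hg φ)) = translationDefect hg h φ := by
  funext w
  have hfst : ∑ z, discreteLog hg g • (carry hg g z • φ w - carry hg (h * g) z • φ w) =
      discreteLog hg g • φ w - discreteLog hg (h * g) • φ w := by
    rw [← smul_sum, sum_sub_distrib, ← sum_smul, ← sum_smul, sum_carry, sum_carry,
      discreteLog_generator, one_smul, one_smul]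
  have hsnd : ∑ z, discreteLog hg z • (carry hg g z • φ w - carry hg g (h * z) • φ w) =
      discreteLog hg g⁻¹ • φ w - discreteLog hg (h * g)⁻¹ • φ w := by
    simp only [smul_sub, smul_comm (discreteLog hg _), sum_sub_distrib,
      sum_carry_generator_smul hg fun z => discreteLog hg z • φ w,
      sum_carry_generator_mul_smul hg h fun z => discreteLog hg z • φ w]
  simp only [lower_apply, translationDefect_cupCarry_cons_cons, sum_add_distrib]
  rw [hfst, hsnd, sum_carry_generator_smul hg fun _ => translationDefect hg h φ w, ← add_assoc,
    sub_add_sub_comm, discreteLog_smul_add_discreteLog_inv_smul hg hM,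
    discreteLog_smul_add_discreteLog_inv_smul hg hM, sub_zero, zero_add]

variable {R}

theorem ev_translationDefect_generatingCocycle_even (hR : (Nat.card G : R) = 0) (h : G) (k : ℕ) :
    ev R g (2 * k) (translationDefect hg h (generatingCocycle hg R (2 * k))) = 0 := by
  induction k with
  | zero => simp [ev, translationDefect]
  | succ k ih =>
    rw [Nat.mul_succ, generatingCocycle, ev, LinearMap.comp_apply,
      lower_translationDefect_cupCarry hg R (fun m => by rw [nsmul_eq_mul, hR, zero_mul]), ih]

theorem ev_translationDefect_generatingCocycle_odd (hR : (Nat.card G : R) = 0) (h : G) (k : ℕ) :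
    ev R g (2 * k + 1) (translationDefect hg h (generatingCocycle hg R (2 * k + 1))) =
      -(discreteLog hg h : R) := by
  induction k with
  | zero =>
    simp [ev, translationDefect, generatingCocycle, discreteLog_generator,
      cast_discreteLog_mul hg hR]
  | succ k ih =>
    rw [Nat.mul_succ, Nat.add_right_comm, generatingCocycle, ev, LinearMap.comp_apply,
      lower_translationDefect_cupCarry hg R (fun m => by rw [nsmul_eq_mul, hR, zero_mul]), ih]

end TranslationDefect

/-! ### Derivations of the group algebra of a cyclic group -/

section Derivation

variable {K G : Type*} [CommRing K] [CommGroup G] {g : G} (hg : ∀ x, x ∈ Subgroup.zpowers g)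

/-- The `K`-linear endomorphism `y ↦ discreteLog y • y` of `K[G]`. -/
noncomputable def eulerLinear : K[G] →ₗ[K] K[G] :=
  (MonoidAlgebra.basis G K).constr K fun y => (discreteLog hg y : K) • MonoidAlgebra.of K G y

theorem eulerLinear_of (y : G) :
    eulerLinear hg (MonoidAlgebra.of K G y) = (discreteLog hg y : K) • MonoidAlgebra.of K G y :=
  (MonoidAlgebra.basis G K).constr_basis K _ y

variable [Finite G]

theorem eulerLinear_mul (hK : (Nat.card G : K) = 0) (a b : K[G]) :
    eulerLinear hg (a * b) = a * eulerLinear hg b + b * eulerLinear hg a := by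
  have hbasis : (LinearMap.mul K K[G]).compr₂ (eulerLinear hg) =
      (LinearMap.mul K K[G]).compl₂ (eulerLinear hg) +
        ((LinearMap.mul K K[G]).compl₂ (eulerLinear hg)).flip := by
    refine LinearMap.ext_basis (MonoidAlgebra.basis G K) (MonoidAlgebra.basis G K) fun y z => ?_
    change eulerLinear hg (MonoidAlgebra.of K G y * MonoidAlgebra.of K G z) =
      MonoidAlgebra.of K G y * eulerLinear hg (MonoidAlgebra.of K G z) +
        MonoidAlgebra.of K G z * eulerLinear hg (MonoidAlgebra.of K G y)
    simp only [← map_mul, eulerLinear_of, cast_discreteLog_mul hg hK, mul_smul_comm, mul_comm z y,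
      add_smul, add_comm]
  exact LinearMap.congr_fun₂ hbasis a b

/-- The Euler derivation `y ↦ discreteLog y • y` of `K[G]`, for `|G| = 0` in `K`. -/
noncomputable def euler (hK : (Nat.card G : K) = 0) : Derivation K K[G] K[G] :=
  Derivation.mk' (eulerLinear hg) (eulerLinear_mul hg hK)

theorem euler_of (hK : (Nat.card G : K) = 0) (y : G) :
    euler hg hK (MonoidAlgebra.of K G y) = (discreteLog hg y : K) • MonoidAlgebra.of K G y :=
  eulerLinear_of hg y

theorem euler_generator [Nontrivial G] (hK : (Nat.card G : K) = 0) :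
    euler hg hK (MonoidAlgebra.of K G g) = MonoidAlgebra.of K G g := by
  rw [euler_of, discreteLog_generator, Nat.cast_one, one_smul]

theorem derivation_eq_of_apply_generator_eq (hg : ∀ x, x ∈ Subgroup.zpowers g)
    {D E : Derivation K K[G] K[G]}
    (h : D (MonoidAlgebra.of K G g) = E (MonoidAlgebra.of K G g)) : D = E := by
  have hDE (y : G) : D (MonoidAlgebra.of K G y) = E (MonoidAlgebra.of K G y) := by
    rw [← pow_discreteLog hg y, map_pow, D.leibniz_pow, E.leibniz_pow, h]
  have hlinear : D.toLinearMap = E.toLinearMap := (MonoidAlgebra.basis G K).ext hDE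
  exact Derivation.ext (LinearMap.congr_fun hlinear)

variable [Nontrivial G] (hK : (Nat.card G : K) = 0)

/-- The derivations of `K[G]` are the multiples `a • E` of the Euler derivation `E`. -/
noncomputable def derivationEquiv : K[G] ≃ₗ[K] Derivation K K[G] K[G] where
  toFun a := a • euler hg hK
  map_add' a b := add_smul a b _
  map_smul' c a := smul_assoc c a _
  invFun D := MonoidAlgebra.of K G g⁻¹ * D (MonoidAlgebra.of K G g)
  left_inv a := by
    beta_reduce
    rw [Derivation.smul_apply, euler_generator, smul_eq_mul, mul_left_comm, ← map_mul,
      inv_mul_cancel, map_one, mul_one]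
  right_inv D := derivation_eq_of_apply_generator_eq hg <| by
    rw [Derivation.smul_apply, euler_generator, smul_eq_mul, mul_right_comm, ← map_mul,
      inv_mul_cancel, map_one, one_mul]

theorem derivationEquiv_apply (a b : K[G]) :
    derivationEquiv hg hK a b = a * euler hg hK b :=
  rfl

theorem lie_derivationEquiv (a b : K[G]) :
    ⁅derivationEquiv hg hK a, derivationEquiv hg hK b⁆ =
      derivationEquiv hg hK (a * euler hg hK b - b * euler hg hK a) := by
  ext1 c
  simp only [Derivation.commutator_apply, derivationEquiv_apply, Derivation.leibniz, smul_eq_mul]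
  ring

/-- The basis of the Witt algebra of derivations of `K[G]` formed by the multiples `gⁱ • E` of the
Euler derivation `E`. -/
noncomputable def wittBasis : Module.Basis (ZMod (Nat.card G)) K (Derivation K K[G] K[G]) :=
  ((MonoidAlgebra.basis G K).reindex
    (Multiplicative.ofAdd.trans (zmodMulEquivOfGenerator hg rfl).toEquiv).symm).map
      (derivationEquiv hg hK)

theorem wittBasis_apply (i : ZMod (Nat.card G)) :
    wittBasis hg hK i = derivationEquiv hg hK (MonoidAlgebra.of K G (g ^ i.val)) := by
  rw [wittBasis, Module.Basis.map_apply, Module.Basis.reindex_apply,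
    ← zmodMulEquivOfGenerator_ofAdd hg]
  rfl

theorem wittBasis_apply_generator (i : ZMod (Nat.card G)) :
    wittBasis hg hK i (MonoidAlgebra.of K G g) = MonoidAlgebra.of K G (g ^ (i.val + 1)) := by
  rw [wittBasis_apply, derivationEquiv_apply, euler_generator, ← map_mul, pow_succ]

theorem lie_wittBasis (i j : ZMod (Nat.card G)) :
    ⁅wittBasis hg hK i, wittBasis hg hK j⁆ =
      ((j.val : K) - (i.val : K)) • wittBasis hg hK (i + j) := by
  have : NeZero (Nat.card G) := ⟨Nat.card_pos.ne'⟩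
  have hlog (k : ZMod (Nat.card G)) : discreteLog hg (g ^ k.val) = k.val := by
    rw [discreteLog_pow, Nat.mod_eq_of_lt k.val_lt]
  have hadd : g ^ (i + j).val = g ^ i.val * g ^ j.val := by
    simp only [← zmodMulEquivOfGenerator_ofAdd hg, ofAdd_add, map_mul]
  rw [wittBasis_apply, wittBasis_apply, wittBasis_apply, lie_derivationEquiv, euler_of, euler_of,
    hlog, hlog, hadd, map_mul, mul_smul_comm, mul_smul_comm,
    mul_comm (MonoidAlgebra.of K G (g ^ j.val)), ← sub_smul, map_smul]

end Derivation

end GroupCochain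

namespace Hochschild

open Finset

/-! ### The first Hochschild cohomology of a commutative algebra -/

section Derivation

variable {K A : Type*} [CommRing K] [CommRing A] [Algebra K A]

/-- The derivation `a ↦ f(a)` given by a `1`-cocycle `f`. -/
def toDerivation (K A : Type*) [CommRing K] [CommRing A] [Algebra K A] :
    cocycles K A 1 →ₗ[K] Derivation K A A where
  toFun f := Derivation.mk' (f : Cochain K A 1).toEnd fun a b => by
    rw [mem_cocycles_one_iff.1 f.2, smul_eq_mul, smul_eq_mul, mul_comm _ b]
  map_add' _ _ := rfl
  map_smul' _ _ := rfl

theorem toDerivation_injective : Function.Injective (toDerivation K A) := fun _ _ h =>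
  Subtype.ext (Cochain.toEnd_injective (congrArg Derivation.toLinearMap h))

theorem toDerivation_surjective : Function.Surjective (toDerivation K A) := fun D =>
  ⟨⟨MultilinearMap.ofSubsingleton K A A 0 D.toLinearMap, mem_cocycles_one_iff.2 fun a b =>
    (D.leibniz a b).trans (congrArg _ (mul_comm b (D a)))⟩, rfl⟩

/-- The Lie algebra homomorphism `HH¹(A) → Der(A)` induced by `toDerivation`. -/
def derivationLieHom (K A : Type*) [CommRing K] [CommRing A] [Algebra K A] :
    HH K A 1 →ₗ⁅K⁆ Derivation K A A where
  toLinearMap := HH.lift (toDerivation K A) fun f hf => by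
    rw [coboundaries_one, Submodule.mem_bot, ZeroMemClass.coe_eq_zero] at hf
    rw [hf, map_zero]
  map_lie' := by
    intro D E
    obtain ⟨D, rfl⟩ := HH.mk_surjective _ D
    obtain ⟨E, rfl⟩ := HH.mk_surjective _ E
    exact Derivation.ext (toEnd_bracketOne (D : Cochain K A 1) (E : Cochain K A 1))

theorem derivationLieHom_bijective : Function.Bijective (derivationLieHom K A) := by
  have hcomp : derivationLieHom K A ∘ HH.mk K A 1 = toDerivation K A := rfl
  constructor
  · exact Function.Injective.of_comp_right (hcomp ▸ toDerivation_injective) (HH.mk_surjective 1)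
  · exact Function.Surjective.of_comp (hcomp ▸ toDerivation_surjective)

/-- The isomorphism of Lie algebras `HH¹(A) ≃ Der(A)` for a commutative algebra `A`. -/
noncomputable def derivationLieEquiv (K A : Type*) [CommRing K] [CommRing A] [Algebra K A] :
    HH K A 1 ≃ₗ⁅K⁆ Derivation K A A :=
  LieEquiv.ofBijective (derivationLieHom K A) derivationLieHom_bijective

theorem derivationLieEquiv_mk (f : cocycles K A 1) :
    derivationLieEquiv K A (HH.mk K A 1 f) = toDerivation K A f :=
  rfl

theorem delta_smul {n : ℕ} (b : A) (f : Cochain K A n) :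
    delta K A n (b • f) = b • delta K A n f := by
  ext x
  simp only [delta_apply, smul_apply, smul_eq_mul, mul_add, mul_sum, mul_smul_comm,
    mul_left_comm b, mul_assoc]

theorem smul_mem_cocycles {n : ℕ} (b : A) {f : Cochain K A n} (hf : f ∈ cocycles K A n) :
    b • f ∈ cocycles K A n := by
  rw [cocycles, LinearMap.mem_ker] at hf ⊢
  rw [delta_smul, hf, smul_zero]

theorem bracketCocycles_coe_eq_bracketOne {n : ℕ} (D : cocycles K A 1) (f : cocycles K A n) :
    (bracketCocycles K A n D f : Cochain K A n) = bracketOne K A n D f :=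
  rfl

theorem bracketOne_smul {n : ℕ} (D : cocycles K A 1) (b : A) (f : Cochain K A n) :
    bracketOne K A n D (b • f) =
      toDerivation K A D b • f + b • bracketOne K A n (D : Cochain K A 1) f := by
  ext x
  have hleibniz : (D : Cochain K A 1).toEnd (b * f x) =
      b * (D : Cochain K A 1).toEnd (f x) + toDerivation K A D b * f x :=
    mem_cocycles_one_iff.1 D.2 b (f x)
  simp only [bracketOne_apply, add_apply, smul_apply, smul_eq_mul,
    hleibniz, ← mul_sum]
  ring

end Derivation

/-! ### Hochschild cochains of a commutative group algebra -/

section GroupAlgebra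

variable {K G : Type*} [CommRing K] [CommGroup G] {n : ℕ}

/-- The group cochain `y ↦ (y₁ ⋯ yₙ)⁻¹ f(y₁, …, yₙ)` of a Hochschild cochain `f`. -/
noncomputable def toGroupCochain (K G : Type*) [CommRing K] [CommGroup G] (n : ℕ) :
    Cochain K K[G] n →ₗ[K[G]] (Fin n → G) → K[G] where
  toFun f y := MonoidAlgebra.of K G (∏ i, y i)⁻¹ * f fun i => MonoidAlgebra.of K G (y i)
  map_add' _ _ := funext fun _ => mul_add _ _ _
  map_smul' _ _ := funext fun _ => mul_left_comm _ _ _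

theorem toGroupCochain_apply (f : Cochain K K[G] n) (y : Fin n → G) :
    toGroupCochain K G n f y =
      MonoidAlgebra.of K G (∏ i, y i)⁻¹ * f fun i => MonoidAlgebra.of K G (y i) :=
  rfl

-- The multiplication is written out since `•` would denote the convolution action of `K[G]` on
-- functions of `y`.
theorem toGroupCochain_smul (b : K[G]) (f : Cochain K K[G] n) :
    toGroupCochain K G n (b • f) = fun y => b * toGroupCochain K G n f y :=
  (toGroupCochain K G n).map_smul b f

theorem of_inv_mul_of_mul (x : G) (a : K[G]) :
    MonoidAlgebra.of K G x⁻¹ * (MonoidAlgebra.of K G x * a) = a := by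
  rw [← mul_assoc, ← map_mul, inv_mul_cancel, map_one, one_mul]

theorem of_prod_mul_toGroupCochain (f : Cochain K K[G] n) (y : Fin n → G) :
    MonoidAlgebra.of K G (∏ i, y i) * toGroupCochain K G n f y =
      f fun i => MonoidAlgebra.of K G (y i) := by
  rw [toGroupCochain_apply, ← mul_assoc, ← map_mul, mul_inv_cancel, map_one, one_mul]

theorem toGroupCochain_injective : Function.Injective (toGroupCochain K G n) := by
  intro f f' h
  refine Module.Basis.ext_multilinear (fun _ => MonoidAlgebra.basis G K) fun y => ?_
  change f (fun i => MonoidAlgebra.of K G (y i)) = f' fun i => MonoidAlgebra.of K G (y i)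
  rw [← of_prod_mul_toGroupCochain, h, of_prod_mul_toGroupCochain]

theorem toGroupCochain_surjective [Finite G] : Function.Surjective (toGroupCochain K G n) := by
  classical
  have := Fintype.ofFinite G
  intro φ
  let f : Cochain K K[G] n := ∑ z, ((MultilinearMap.mkPiAlgebra K (Fin n) K).compLinearMap
    fun i => (MonoidAlgebra.basis G K).coord (z i)).smulRight
      (MonoidAlgebra.of K G (∏ i, z i) * φ z)
  have hcoord (z y : Fin n → G) :
      ∏ i, (MonoidAlgebra.basis G K).coord (z i) (MonoidAlgebra.basis G K (y i)) =
        if z = y then 1 else 0 := by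
    simp only [Module.Basis.coord_apply, Module.Basis.repr_self, Finsupp.single_apply,
      Fintype.prod_ite_zero, prod_const_one, funext_iff, eq_comm]
  have hf (y : Fin n → G) :
      f (fun i => MonoidAlgebra.basis G K (y i)) = MonoidAlgebra.of K G (∏ i, y i) * φ y := by
    simp only [f, _root_.sum_apply, MultilinearMap.smulRight_apply,
      MultilinearMap.compLinearMap_apply, MultilinearMap.mkPiAlgebra_apply, hcoord, ite_smul,
      one_smul, zero_smul, sum_ite_eq', mem_univ, if_true]
  refine ⟨f, funext fun y => ?_⟩
  rw [toGroupCochain_apply]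
  exact (congrArg _ (hf y)).trans (of_inv_mul_of_mul _ _)

/-- The identification of Hochschild cochains of `K[G]` with group cochains. -/
noncomputable def groupCochainEquiv (K G : Type*) [CommRing K] [CommGroup G] [Finite G] (n : ℕ) :
    Cochain K K[G] n ≃ₗ[K[G]] ((Fin n → G) → K[G]) :=
  LinearEquiv.ofBijective (toGroupCochain K G n)
    ⟨toGroupCochain_injective, toGroupCochain_surjective⟩

theorem prod_contractNth {M : Type*} [CommMonoid M] {n : ℕ} (i : Fin n) (y : Fin (n + 1) → M) :
    ∏ j, Fin.contractNth i.castSucc (· * ·) y j = ∏ j, y j := by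
  induction n with
  | zero => exact i.elim0
  | succ n ih =>
    rw [← Fin.cons_self_tail y]
    cases i using Fin.cases with
    | zero =>
      rw [GroupCochain.contractNth_zero_cons, Fin.prod_cons, Fin.prod_cons, mul_assoc,
        Fin.prod_univ_succ (Fin.tail y)]
      rfl
    | succ i => rw [GroupCochain.contractNth_succ_cons, Fin.prod_cons, Fin.prod_cons, ih]

theorem toGroupCochain_delta (f : Cochain K K[G] n) :
    toGroupCochain K G (n + 1) (delta K K[G] n f) =
      GroupCochain.d K[G] (toGroupCochain K G n f) := by
  funext y
  have hcontract (i : Fin n) :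
      Fin.contractNth i.castSucc (· * ·) (fun j => MonoidAlgebra.of K G (y j)) =
        fun j => MonoidAlgebra.of K G (Fin.contractNth i.castSucc (· * ·) y j) :=
    (Fin.comp_contractNth (· * ·) (· * ·) (map_mul (MonoidAlgebra.of K G)) i.castSucc y).symm
  have htail : MonoidAlgebra.of K G (y 0) * f (fun j => MonoidAlgebra.of K G (Fin.tail y j)) =
      MonoidAlgebra.of K G (∏ j, y j) * toGroupCochain K G n f (Fin.tail y) := by
    rw [← of_prod_mul_toGroupCochain, ← mul_assoc, ← map_mul, Fin.prod_univ_succ y]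
    rfl
  have hinit : f (fun j => MonoidAlgebra.of K G (Fin.init y j)) *
      MonoidAlgebra.of K G (y (Fin.last n)) =
        MonoidAlgebra.of K G (∏ j, y j) * toGroupCochain K G n f (Fin.init y) := by
    rw [← of_prod_mul_toGroupCochain, mul_right_comm, ← map_mul, Fin.prod_univ_castSucc y]
    rfl
  have hsign (k : ℕ) (a : K[G]) : (-1 : K) ^ k • a = (-1 : ℤ) ^ k • a := by
    simp [← Int.cast_smul_eq_zsmul K]
  have hdelta : delta K K[G] n f (fun j => MonoidAlgebra.of K G (y j)) =
      MonoidAlgebra.of K G (∏ j, y j) * GroupCochain.d K[G] (toGroupCochain K G n f) y := by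
    rw [GroupCochain.d_apply, mul_add, mul_add, ← htail, mul_sum, mul_smul_comm, ← hinit]
    simp only [delta_apply, hcontract, hsign, prod_contractNth, mul_smul_comm,
      ← of_prod_mul_toGroupCochain f (Fin.contractNth _ _ y)]
    rfl
  rw [toGroupCochain_apply, hdelta, of_inv_mul_of_mul]

theorem d_toGroupCochain_eq_zero_iff {f : Cochain K K[G] n} :
    GroupCochain.d K[G] (toGroupCochain K G n f) = 0 ↔ f ∈ cocycles K K[G] n := by
  rw [← toGroupCochain_delta, cocycles, LinearMap.mem_ker,
    map_eq_zero_iff _ toGroupCochain_injective]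

theorem toGroupCochain_mem_coboundaries_iff [Finite G] {f : Cochain K K[G] n} :
    toGroupCochain K G n f ∈ GroupCochain.coboundaries G K[G] K[G] n ↔
      f ∈ coboundaries K K[G] n := by
  cases n with
  | zero => exact map_eq_zero_iff _ toGroupCochain_injective
  | succ n =>
    simp only [GroupCochain.coboundaries, coboundaries, LinearMap.mem_range,
      toGroupCochain_surjective.exists, ← toGroupCochain_delta, toGroupCochain_injective.eq_iff]

theorem prod_update_mul_left (y : Fin n → G) (l : Fin n) (h : G) :
    ∏ i, Function.update y l (h * y l) i = h * ∏ i, y i := by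
  rw [prod_update_of_mem (mem_univ l), mul_assoc, ← prod_update_of_mem (mem_univ l),
    Function.update_eq_self]

theorem apply_update_of_mul (f : Cochain K K[G] n) (y : Fin n → G) (l : Fin n) (h : G) :
    f (Function.update (fun i => MonoidAlgebra.of K G (y i)) l (MonoidAlgebra.of K G (h * y l))) =
      MonoidAlgebra.of K G (∏ i, y i) *
        (MonoidAlgebra.of K G h * toGroupCochain K G n f (Function.update y l (h * y l))) := by
  have hupdate := Function.comp_update (MonoidAlgebra.of K G) y l (h * y l)
  rw [← mul_assoc, ← map_mul, mul_comm (∏ i, y i), ← prod_update_mul_left y l,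
    of_prod_mul_toGroupCochain]
  exact congrArg f hupdate.symm

open GroupCochain in
theorem toGroupCochain_bracketOne [Finite G] {g : G} (hg : ∀ x, x ∈ Subgroup.zpowers g)
    (hK : (Nat.card G : K) = 0) (h : G) {D : cocycles K K[G] 1}
    (hD : toDerivation K K[G] D = MonoidAlgebra.of K G h • euler hg hK) (f : Cochain K K[G] n)
    (y : Fin n → G) :
    toGroupCochain K G n (bracketOne K K[G] n D f) y =
      MonoidAlgebra.of K G h * (euler hg hK (toGroupCochain K G n f y) +
        translationDefect hg h (toGroupCochain K G n f) y) := by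
  have hD_apply (a : K[G]) : (D : Cochain K K[G] 1).toEnd a =
      MonoidAlgebra.of K G h * euler hg hK a :=
    congrArg (fun E : Derivation K K[G] K[G] => E a) hD
  have houter : (D : Cochain K K[G] 1).toEnd (f fun i => MonoidAlgebra.of K G (y i)) =
      MonoidAlgebra.of K G (∏ i, y i) * (MonoidAlgebra.of K G h *
        (euler hg hK (toGroupCochain K G n f y) +
          ∑ l, (discreteLog hg (y l) : K) • toGroupCochain K G n f y)) := by
    rw [hD_apply, ← of_prod_mul_toGroupCochain, Derivation.leibniz, euler_of,
      cast_discreteLog_prod hg hK, ← sum_smul, smul_eq_mul, smul_eq_mul, mul_smul_comm,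
      mul_comm (toGroupCochain K G n f y), ← mul_smul_comm, ← mul_add, mul_left_comm]
  have hinner (l : Fin n) : f (Function.update (fun i => MonoidAlgebra.of K G (y i)) l
      ((D : Cochain K K[G] 1).toEnd (MonoidAlgebra.of K G (y l)))) =
      MonoidAlgebra.of K G (∏ i, y i) * (MonoidAlgebra.of K G h *
        ((discreteLog hg (y l) : K) •
          toGroupCochain K G n f (Function.update y l (h * y l)))) := by
    rw [hD_apply, euler_of, mul_smul_comm, ← map_mul, f.map_update_smul, apply_update_of_mul,
      mul_smul_comm, mul_smul_comm]
  rw [toGroupCochain_apply, bracketOne_apply, houter, sum_congr rfl fun l _ => hinner l, ← mul_sum,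
    ← mul_sum, ← mul_sub, ← mul_sub, of_inv_mul_of_mul, add_sub_assoc, ← sum_sub_distrib]
  simp only [translationDefect, ← Nat.cast_smul_eq_nsmul K, smul_sub]

end GroupAlgebra

/-! ### Hochschild cohomology of the group algebra of a cyclic group -/

section Cyclic

open GroupCochain

variable {K G : Type*} [CommRing K] [CommGroup G]

theorem natCast_card_eq_zero (hK : (Nat.card G : K) = 0) : (Nat.card G : K[G]) = 0 := by
  rw [← map_natCast (algebraMap K K[G]), hK, map_zero]

variable {g : G} (hg : ∀ x, x ∈ Subgroup.zpowers g)

theorem euler_generatingCocycle [Finite G] (hK : (Nat.card G : K) = 0) :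
    (n : ℕ) → (y : Fin n → G) → euler hg hK (generatingCocycle hg K[G] n y) = 0
  | 0, _ => (euler hg hK).map_one_eq_zero
  | 1, y => (euler hg hK).map_natCast (discreteLog hg (y 0))
  | n + 2, y => by
    change euler hg hK (carry hg (y 0) (y 1) • generatingCocycle hg K[G] n _) = 0
    rw [map_nsmul, euler_generatingCocycle hK n, smul_zero]

/-- The Hochschild cocycle whose class freely generates `HHⁿ(K[G])` over `K[G]`. -/
noncomputable def cyclicCocycle [Finite G] (hK : (Nat.card G : K) = 0) (n : ℕ) :
    cocycles K K[G] n :=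
  ⟨(groupCochainEquiv K G n).symm (generatingCocycle hg K[G] n),
    d_toGroupCochain_eq_zero_iff.1 <| by
      rw [← d_generatingCocycle hg (natCast_card_eq_zero hK) n]
      exact congrArg _ ((groupCochainEquiv K G n).apply_symm_apply _)⟩

theorem toGroupCochain_cyclicCocycle [Finite G] (hK : (Nat.card G : K) = 0) (n : ℕ) :
    toGroupCochain K G n (cyclicCocycle hg hK n) = generatingCocycle hg K[G] n :=
  (groupCochainEquiv K G n).apply_symm_apply _

variable [Fintype G] (hK : (Nat.card G : K) = 0)

/-- The map `HHⁿ(K[G]) → K[G]` induced by the evaluation `ev` of group cochains. -/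
noncomputable def evHH (g : G) (hK : (Nat.card G : K) = 0) (n : ℕ) : HH K K[G] n →ₗ[K] K[G] :=
  have : IsScalarTower K K[G] (Cochain K K[G] n) :=
    ⟨fun _ _ _ => MultilinearMap.ext fun _ => smul_assoc _ _ _⟩
  HH.lift ((ev K[G] g n ∘ₗ toGroupCochain K G n).restrictScalars K ∘ₗ (cocycles K K[G] n).subtype)
    fun _ hf => ev_eq_zero_of_mem_coboundaries
      (fun m => by rw [nsmul_eq_mul, natCast_card_eq_zero hK, zero_mul])
      (toGroupCochain_mem_coboundaries_iff.2 hf)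

theorem evHH_mk {n : ℕ} (f : cocycles K K[G] n) :
    evHH g hK n (HH.mk K K[G] n f) = ev K[G] g n (toGroupCochain K G n f) :=
  rfl

theorem evHH_injective (hg : ∀ x, x ∈ Subgroup.zpowers g) (n : ℕ) :
    Function.Injective (evHH g hK n) := by
  refine (injective_iff_map_eq_zero _).2 fun ξ hξ => ?_
  obtain ⟨f, rfl⟩ := HH.mk_surjective _ ξ
  exact HH.mk_eq_zero.2 (toGroupCochain_mem_coboundaries_iff.1
    (mem_coboundaries_of_ev_eq_zero hg n _ (d_toGroupCochain_eq_zero_iff.2 f.2) hξ))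

variable [Nontrivial G]

theorem evHH_mk_smul_cyclicCocycle (n : ℕ) (b : K[G]) :
    evHH g hK n (HH.mk K K[G] n ⟨b • (cyclicCocycle hg hK n : Cochain K K[G] n),
      smul_mem_cocycles b (cyclicCocycle hg hK n).2⟩) = b := by
  rw [evHH_mk, toGroupCochain_smul, ev_mul_left, toGroupCochain_cyclicCocycle, ev_generatingCocycle,
    mul_one]

/-- The isomorphism `HHⁿ(K[G]) ≃ K[G]` sending the class of `cyclicCocycle` to `1`. -/
noncomputable def evEquiv (n : ℕ) : HH K K[G] n ≃ₗ[K] K[G] :=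
  LinearEquiv.ofBijective (evHH g hK n)
    ⟨evHH_injective hK hg n, fun b => ⟨_, evHH_mk_smul_cyclicCocycle hg hK n b⟩⟩

theorem evEquiv_mk {n : ℕ} (f : cocycles K K[G] n) :
    evEquiv hg hK n (HH.mk K K[G] n f) = ev K[G] g n (toGroupCochain K G n f) :=
  rfl

theorem evEquiv_lie {n : ℕ} (D : HH K K[G] 1) (ξ : HH K K[G] n) :
    evEquiv hg hK n ⁅D, ξ⁆ = derivationLieEquiv K K[G] D (evEquiv hg hK n ξ) +
      evEquiv hg hK n ξ * evEquiv hg hK n ⁅D, HH.mk K K[G] n (cyclicCocycle hg hK n)⁆ := by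
  obtain ⟨D, rfl⟩ := HH.mk_surjective _ D
  obtain ⟨b, rfl⟩ : ∃ b : K[G], HH.mk K K[G] n ⟨b • (cyclicCocycle hg hK n : Cochain K K[G] n),
      smul_mem_cocycles b (cyclicCocycle hg hK n).2⟩ = ξ :=
    ⟨_, evHH_injective hK hg n (evHH_mk_smul_cyclicCocycle hg hK n _)⟩
  simp only [lie_def, bracketHH_mk, derivationLieEquiv_mk, evEquiv_mk,
    bracketCocycles_coe_eq_bracketOne, bracketOne_smul, map_add, toGroupCochain_smul, ev_mul_left,
    toGroupCochain_cyclicCocycle, ev_generatingCocycle, mul_one]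

/-- The class in `HH¹(K[G])` of the derivation `a • E`, where `E` is the Euler derivation. -/
noncomputable def eulerClass : K[G] ≃ₗ[K] HH K K[G] 1 :=
  derivationEquiv hg hK ≪≫ₗ (derivationLieEquiv K K[G]).toLinearEquiv.symm

theorem derivationLieEquiv_eulerClass (a : K[G]) :
    derivationLieEquiv K K[G] (eulerClass hg hK a) = derivationEquiv hg hK a :=
  (derivationLieEquiv K K[G]).toLinearEquiv.apply_symm_apply _

theorem evEquiv_lie_eulerClass_of (n : ℕ) (h : G) :
    evEquiv hg hK n
        ⁅eulerClass hg hK (MonoidAlgebra.of K G h), HH.mk K K[G] n (cyclicCocycle hg hK n)⁆ =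
      MonoidAlgebra.of K G h *
        ev K[G] g n (translationDefect hg h (generatingCocycle hg K[G] n)) := by
  obtain ⟨D, hmk⟩ := HH.mk_surjective _ (eulerClass hg hK (MonoidAlgebra.of K G h))
  have hD : toDerivation K K[G] D = MonoidAlgebra.of K G h • euler hg hK := by
    rw [← derivationLieEquiv_mk, hmk, derivationLieEquiv_eulerClass]
    rfl
  have hbracket : toGroupCochain K G n (bracketOne K K[G] n D (cyclicCocycle hg hK n)) =
      fun y => MonoidAlgebra.of K G h *
        translationDefect hg h (generatingCocycle hg K[G] n) y := by
    funext y
    rw [toGroupCochain_bracketOne hg hK h hD, toGroupCochain_cyclicCocycle,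
      euler_generatingCocycle, zero_add]
  rw [← hmk, lie_def, bracketHH_mk, evEquiv_mk, bracketCocycles_coe_eq_bracketOne, hbracket,
    ev_mul_left]

theorem evEquiv_lie_eulerClass_even {n : ℕ} (hn : Even n) (a : K[G]) :
    evEquiv hg hK n ⁅eulerClass hg hK a, HH.mk K K[G] n (cyclicCocycle hg hK n)⁆ = 0 := by
  induction a using MonoidAlgebra.induction_on with
  | of h =>
    obtain ⟨k, rfl⟩ := hn.two_dvd
    rw [evEquiv_lie_eulerClass_of,
      ev_translationDefect_generatingCocycle_even hg (natCast_card_eq_zero hK), mul_zero]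
  | add a b iha ihb => rw [map_add, add_lie, map_add, iha, ihb, add_zero]
  | smul r a iha => rw [map_smul, smul_lie, map_smul, iha, smul_zero]

theorem evEquiv_lie_eulerClass_odd {n : ℕ} (hn : Odd n) (a : K[G]) :
    evEquiv hg hK n ⁅eulerClass hg hK a, HH.mk K K[G] n (cyclicCocycle hg hK n)⁆ =
      -euler hg hK a := by
  induction a using MonoidAlgebra.induction_on with
  | of h =>
    obtain ⟨k, rfl⟩ := hn
    rw [evEquiv_lie_eulerClass_of,
      ev_translationDefect_generatingCocycle_odd hg (natCast_card_eq_zero hK), euler_of, mul_neg,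
      mul_comm, ← nsmul_eq_mul, Nat.cast_smul_eq_nsmul]
  | add a b iha ihb => rw [map_add, add_lie, map_add, iha, ihb, map_add, neg_add]
  | smul r a iha => rw [map_smul, smul_lie, map_smul, iha, Derivation.map_smul, smul_neg]

theorem evEquiv_lie_even {n : ℕ} (hn : Even n) (D : HH K K[G] 1) (ξ : HH K K[G] n) :
    evEquiv hg hK n ⁅D, ξ⁆ = derivationLieEquiv K K[G] D (evEquiv hg hK n ξ) := by
  obtain ⟨a, rfl⟩ := (eulerClass hg hK).surjective D
  rw [evEquiv_lie, evEquiv_lie_eulerClass_even hg hK hn, mul_zero, add_zero]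

theorem derivationEquiv_evEquiv_lie_odd {n : ℕ} (hn : Odd n) (D : HH K K[G] 1)
    (ξ : HH K K[G] n) :
    derivationEquiv hg hK (evEquiv hg hK n ⁅D, ξ⁆) =
      ⁅derivationLieEquiv K K[G] D, derivationEquiv hg hK (evEquiv hg hK n ξ)⁆ := by
  obtain ⟨a, rfl⟩ := (eulerClass hg hK).surjective D
  rw [evEquiv_lie, evEquiv_lie_eulerClass_odd hg hK hn, derivationLieEquiv_eulerClass,
    lie_derivationEquiv, derivationEquiv_apply, mul_neg, ← sub_eq_add_neg]

end Cyclic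

end Hochschild

theorem mainTheorem5_general (K : Type*) [CommRing K] [Nontrivial K] (G : Type*) [CommGroup G]
    [Finite G] [IsCyclic G] (hK : (Nat.card G : K) = 0) :
    ∃ θ : Hochschild.HH K K[G] 1 ≃ₗ⁅K⁆ Derivation K K[G] K[G],
      (∀ (f : Hochschild.cocycles K K[G] 1) (a : K[G]),
        θ (Hochschild.HH.mk K K[G] 1 f) a = (f : Hochschild.Cochain K K[G] 1) fun _ => a) ∧
      (∀ g : G, (∀ x : G, x ∈ Subgroup.zpowers g) →
        ∃ D : Module.Basis (ZMod (Nat.card G)) K (Derivation K K[G] K[G]),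
          (∀ i, D i (MonoidAlgebra.of K G g) = MonoidAlgebra.of K G (g ^ (i.val + 1))) ∧
          ∀ i j, ⁅D i, D j⁆ = ((j.val : K) - (i.val : K)) • D (i + j)) ∧
      (∀ n : ℕ, Odd n → ∃ e : Hochschild.HH K K[G] n ≃ₗ[K] Derivation K K[G] K[G],
        ∀ (D : Hochschild.HH K K[G] 1) (ξ : Hochschild.HH K K[G] n), e ⁅D, ξ⁆ = ⁅θ D, e ξ⁆) ∧
      (∀ n : ℕ, Even n → ∃ e : Hochschild.HH K K[G] n ≃ₗ[K] K[G],
        ∀ (D : Hochschild.HH K K[G] 1) (ξ : Hochschild.HH K K[G] n), e ⁅D, ξ⁆ = θ D (e ξ)) := by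
  have := Fintype.ofFinite G
  have : Nontrivial G := by
    by_contra h
    rw [not_nontrivial_iff_subsingleton] at h
    rw [Nat.card_unique, Nat.cast_one] at hK
    exact one_ne_zero hK
  obtain ⟨g₀, hg₀⟩ := IsCyclic.exists_generator (α := G)
  exact ⟨Hochschild.derivationLieEquiv K K[G], fun _ _ => rfl,
    fun g hg => ⟨GroupCochain.wittBasis hg hK, GroupCochain.wittBasis_apply_generator hg hK,
      GroupCochain.lie_wittBasis hg hK⟩,
    fun n hn => ⟨Hochschild.evEquiv hg₀ hK n ≪≫ₗ GroupCochain.derivationEquiv hg₀ hK,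
      Hochschild.derivationEquiv_evEquiv_lie_odd hg₀ hK hn⟩,
    fun n hn => ⟨Hochschild.evEquiv hg₀ hK n, Hochschild.evEquiv_lie_even hg₀ hK hn⟩⟩

theorem mainTheorem5 (p : ℕ) (hp : p.Prime) (hp2 : p ≠ 2)
    (K : Type*) [Field K] [CharP K p]
    (G : Type*) [CommGroup G] [Finite G] [IsCyclic G] (hG : p ∣ Nat.card G) :
    -- `HH¹(KG)` is the Lie algebra of derivations of `KG`, via `[f] ↦ (a ↦ f a)`
    ∃ θ : Hochschild.HH K (MonoidAlgebra K G) 1 ≃ₗ⁅K⁆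
        Derivation K (MonoidAlgebra K G) (MonoidAlgebra K G),
      (∀ (f : Hochschild.cocycles K (MonoidAlgebra K G) 1) (a : MonoidAlgebra K G),
        θ (Hochschild.HH.mk K (MonoidAlgebra K G) 1 f) a =
          (f : Hochschild.Cochain K (MonoidAlgebra K G) 1) fun _ => a) ∧
      -- which is the Witt algebra with basis `D_i`, `D_i(g) = g^{i+1}`
      (∀ g : G, (∀ x : G, x ∈ Subgroup.zpowers g) →
        ∃ D : Module.Basis (ZMod (Nat.card G)) K
            (Derivation K (MonoidAlgebra K G) (MonoidAlgebra K G)),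
          (∀ i, D i (MonoidAlgebra.of K G g) = MonoidAlgebra.of K G (g ^ (i.val + 1))) ∧
          ∀ i j, ⁅D i, D j⁆ = ((j.val : K) - (i.val : K)) • D (i + j)) ∧
      -- in odd degree, `HHⁿ(KG)` is the adjoint module
      (∀ n : ℕ, Odd n →
        ∃ e : Hochschild.HH K (MonoidAlgebra K G) n ≃ₗ[K]
            Derivation K (MonoidAlgebra K G) (MonoidAlgebra K G),
          ∀ (D : Hochschild.HH K (MonoidAlgebra K G) 1)
            (ξ : Hochschild.HH K (MonoidAlgebra K G) n), e ⁅D, ξ⁆ = ⁅θ D, e ξ⁆) ∧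
      -- in even degree, `HHⁿ(KG)` is the standard module
      (∀ n : ℕ, Even n →
        ∃ e : Hochschild.HH K (MonoidAlgebra K G) n ≃ₗ[K] MonoidAlgebra K G,
          ∀ (D : Hochschild.HH K (MonoidAlgebra K G) 1)
            (ξ : Hochschild.HH K (MonoidAlgebra K G) n), e ⁅D, ξ⁆ = θ D (e ξ)) :=
  mainTheorem5_general K G ((CharP.cast_eq_zero_iff K p _).2 hG)
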